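/- A tree is a partial order $(T,\sqsubseteq)$ in which the set $P_t$ of strict predecessors of each node $t$ is well ordered; $\mathrm{Lev}_\alpha(T)$ is the set of $t$ with $P_t$ of order type $\alpha$, and the height of $T$ is the least $\alpha$ with $\mathrm{Lev}_\alpha(T)=\emptyset$. A generalized Aronszajn tree is a tree of height $\omega_1$ with no uncountable branch (maximal chain) that is rooted (there is a unique minimal node) and normal (every node is comparable with some node of each level below $\omega_1$, and two nodes on the same limit level with the same predecessors are equal); the levels may have any size. For such a $T$ let $\mathbb P(T)$ be the set of finite partial functions $p:T\to\omega$ with $p(s)\ne p(t)$ whenever $s\sqsubset t$ are in $\mathrm{dom}(p)$, ordered by reverse inclusion, and let $g_T$ be the union of the generic filter. For $A\subseteq T$ non-empty, countable and downward closed, let $\partial A=\{s\in T\setminus A: P_s\subseteq A\}$, and let $\mathbb Q_A$ be the set of pairs $(s,\pi)$ such that $s\in\mathbb P(T)$, $\mathrm{dom}(s)\subseteq A$, $\pi$ is a finite partial function from $\partial A$ to $[\omega]^{<\omega}$, and $s(t)\neq n$ whenever $t\in\mathrm{dom}(s)$, $t'\in\mathrm{dom}(\pi)$, $t\sqsubseteq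 t'$ and $n\in\pi(t')$; put $(s,\pi)\le(r,\tau)$ iff $s\supseteq r$, $\mathrm{dom}(\pi)\supseteq\mathrm{dom}(\tau)$ and $\pi(t)\supseteq\tau(t)$ for all $t\in\mathrm{dom}(\tau)$. Let $\dot h$ be the $\mathbb Q_A$-name for the union of the first coordinates of the conditions in the generic filter, and let $\dot{\mathbb R}(\dot h)$ be the $\mathbb Q_A$-name for the set of finite partial functions $p:T\setminus A\to\omega$ such that $p\cup\dot h$ is a partial function from $T$ to $\omega$ that is injective on chains, ordered by reverse inclusion. Theorem. Let $T$ be a generalized Aronszajn tree. (1) For every non-empty countable downward closed $A\subseteq T$, the forcing $\mathbb Q_A$ is $\sigma$-centered, and there is a dense embedding $e_A$ of $\mathbb P(T)$ into $\mathbb Q_A*\dot{\mathbb R}(\dot h)$ which is an isomorphism onto its (dense) range and sends $p$ to a condition whose first coordinate has stem $p\restriction A$ and forces the second coordinate to be $p\restriction(T\setminus A)$. The first coordinate of $e_A$ is a projection from $\mathbb P(T)$ to $\mathbb Q_A$, so that a $V$-generic $G\subseteq\mathbb P(T)$ induces a $V$-generic $H_A\subseteq\mathbb Q_A$ in $V[G]$,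 and $\dot h^{H_A}=g_T\restriction A$. (2) Every countable set of ordinals added by $\mathbb P(T)$ lies in such a $\sigma$-centered subextension $V[H_A]$: for every $\mathbb P(T)$-name $\dot x$ and every $p\in\mathbb P(T)$ that forces $\dot x$ to be a countable set of ordinals there are a non-empty countable downward closed $A\subseteq T$ and a $\mathbb Q_A$-name $\dot y$ such that $p$ forces $\dot x=\dot y^{\dot H_A}$. -/

import Mathlib

universe u

namespace SpecialTree

/-! ## Trees -/

/-- A tree: a partial order in which the strict predecessors of every node are well ordered. -/
class IsTreeOrder (T : Type u) [PartialOrder T] : Prop where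
  wellOrder : ∀ t : T, IsWellOrder (Set.Iio t) (· < ·)

/-- The order type of the set of strict predecessors of `t`. -/
noncomputable def ht {T : Type u} [PartialOrder T] [IsTreeOrder T] (t : T) : Ordinal.{u} :=
  haveI := IsTreeOrder.wellOrder t
  Ordinal.type (fun a b : Set.Iio t => a < b)

/-- The `α`-th level of the tree. -/
def lev (T : Type u) [PartialOrder T] [IsTreeOrder T] (α : Ordinal.{u}) : Set T :=
  {t | ht t = α}

/-- `α` is the height of `T`: the least ordinal whose level is empty. -/
def HasHeight (T : Type u) [PartialOrder T] [IsTreeOrder T] (α : Ordinal.{u}) : Prop :=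
  IsLeast {β | lev T β = ∅} α

/-- Normal trees (of height `α`): every node is comparable with a node on every level below the
height, and nodes on a limit level are determined by their predecessors. -/
structure IsNormalTree (T : Type u) [PartialOrder T] [IsTreeOrder T] (α : Ordinal.{u}) :
    Prop where
  comparable : ∀ t : T, ∀ β < α, ∃ s ∈ lev T β, s ≤ t ∨ t ≤ s
  limit_unique : ∀ δ : Ordinal.{u}, Order.IsSuccLimit δ → ∀ s ∈ lev T δ, ∀ t ∈ lev T δ,
    Set.Iio s = Set.Iio t → s = t

/-- A generalized Aronszajn tree: a normal rooted tree of height `ω₁` without uncountable branch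
(a branch is a maximal chain); there is no restriction on the size of the levels. -/
structure IsGenAronszajn (T : Type u) [PartialOrder T] [IsTreeOrder T] : Prop where
  height : HasHeight T (Ordinal.omega 1)
  normal : IsNormalTree T (Ordinal.omega 1)
  rooted : ∃! r : T, IsMin r
  branch : ∀ b : Set T, IsMaxChain (· ≤ ·) b → b.Countable

/-! ## Forcing notions -/

/-- Two conditions are compatible if they have a common extension. -/
def Compat {P : Type*} [Preorder P] (p q : P) : Prop := ∃ r, r ≤ p ∧ r ≤ q

/-- A set of conditions is centered if each of its finite subsets has a common extension. -/
def Centered {P : Type*} [Preorder P] (C : Set P) : Prop :=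
  ∀ F : Finset P, (F : Set P) ⊆ C → ∃ q : P, ∀ p ∈ F, q ≤ p

/-- A forcing notion is σ-centered if it is a countable union of centered sets. -/
def SigmaCentered (P : Type*) [Preorder P] : Prop :=
  ∃ C : ℕ → Set P, (∀ n, Centered (C n)) ∧ ⋃ n, C n = Set.univ

/-- A dense embedding of forcing notions: an order embedding that preserves incompatibility and
has dense range. -/
structure IsDenseEmb {P Q : Type*} [Preorder P] [Preorder Q] (e : P → Q) : Prop where
  le_iff : ∀ p p', e p ≤ e p' ↔ p ≤ p'
  incompat : ∀ p p', ¬ Compat p p' → ¬ Compat (e p) (e p')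
  dense : ∀ q, ∃ p, e p ≤ q

/-- A projection of forcing notions; if `G` is generic for `P`, then the upward closure of
`f '' G` is generic for `Q`. -/
structure IsProjection {P Q : Type*} [Preorder P] [Preorder Q] [OrderTop P] [OrderTop Q]
    (f : P → Q) : Prop where
  mono : ∀ p p', p ≤ p' → f p ≤ f p'
  top : f ⊤ = ⊤
  lift : ∀ p, ∀ q ≤ f p, ∃ p' ≤ p, f p' ≤ q

/-! ## Names and the forcing relation -/

/-- `P`-names: `mk ι a c` is the name `{(a i, c i) | i : ι}`. -/
inductive Name (P : Type u) : Type (u + 1)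
  | mk (ι : Type u) (a : ι → Name P) (c : ι → P) : Name P

/-- A sentence of the forcing language, given by the conditions that force it:
`φ p` reads `p ⊩ φ`. -/
abbrev Sent (P : Type u) : Type u := P → Prop

section Logic

variable {P : Type u} [Preorder P]

/-- Negation. -/
def fnot (φ : Sent P) : Sent P := fun p => ∀ q ≤ p, ¬ φ q

/-- Conjunction. -/
def fand (φ ψ : Sent P) : Sent P := fun p => φ p ∧ ψ p

/-- Implication. -/
def fimp (φ ψ : Sent P) : Sent P := fun p => ∀ q ≤ p, φ q → ψ q

/-- Universal quantifier, over all names or over (check names of) ground model objects. -/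
def fall {X : Type*} (φ : X → Sent P) : Sent P := fun p => ∀ x, φ x p

/-- Existential quantifier. -/
def fex {X : Type*} (φ : X → Sent P) : Sent P := fun p => ∀ q ≤ p, ∃ r ≤ q, ∃ x, φ x r

/-- `p ⊩ x = y`: each `(a i, c i) ∈ x` is forced into `y` by all `q ≤ p, c i`, and vice versa. -/
def feq : Name P → Name P → Sent P
  | .mk ι a c, .mk κ b d => fun p =>
    (∀ i : ι, ∀ q ≤ p, q ≤ c i → ∃ r ≤ q, ∃ j : κ, r ≤ d j ∧ feq (a i) (b j) r) ∧
    (∀ j : κ, ∀ q ≤ p, q ≤ d j → ∃ r ≤ q, ∃ i : ι, r ≤ c i ∧ feq (a i) (b j) r)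

/-- `p ⊩ x ∈ y`: the set of `r` with `r ⊩ x = b` for some `(b, d) ∈ y`, `r ≤ d`, is dense
below `p`. -/
def fmem (x : Name P) : Name P → Sent P
  | .mk κ b d => fun p => ∀ q ≤ p, ∃ r ≤ q, ∃ j : κ, r ≤ d j ∧ feq x (b j) r

/-- `x ⊆ y`. -/
def fsub (x y : Name P) : Sent P := fall fun z : Name P => fimp (fmem z x) (fmem z y)

/-- `∀ z ∈ x, φ z`. -/
def fallIn (x : Name P) (φ : Name P → Sent P) : Sent P :=
  fall fun z : Name P => fimp (fmem z x) (φ z)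

/-- `∃ z ∈ x, φ z`. -/
def fexIn (x : Name P) (φ : Name P → Sent P) : Sent P :=
  fex fun z : Name P => fand (fmem z x) (φ z)

/-- `x` is a transitive set. -/
def fTrans (x : Name P) : Sent P := fallIn x fun y => fsub y x

/-- `x` is an ordinal: a transitive set of transitive sets. -/
def fOrd (x : Name P) : Sent P := fand (fTrans x) (fallIn x fTrans)

end Logic

section Names

variable {P : Type u} [Preorder P] [OrderTop P]

/-- The canonical name `x̌` of a ground model set. -/
def check : PSet.{u} → Name P
  | .mk ι a => .mk ι (fun i => check (a i)) (fun _ => ⊤)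

/-- The canonical name of the unordered pair. -/
def upair (x y : Name P) : Name P :=
  .mk (ULift Bool) (fun b => if b.down then x else y) (fun _ => ⊤)

/-- The canonical name of the (Kuratowski) ordered pair. -/
def opair (x y : Name P) : Name P := upair (upair x x) (upair x y)

/-- The canonical name of the union of two sets. -/
def union : Name P → Name P → Name P
  | .mk ι a c, .mk κ b d => .mk (ι ⊕ κ) (Sum.elim a b) (Sum.elim c d)

/-- `f` is single-valued. -/
def fFunctional (f : Name P) : Sent P :=
  fall fun x : Name P => fall fun y : Name P => fall fun z : Name P =>
    fimp (fand (fmem (opair x y) f) (fmem (opair x z) f)) (feq y z)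

/-- Some function maps a subset of `d` onto a set that includes `x`. -/
def fEnumerable (d x : Name P) : Sent P :=
  fex fun f : Name P => fand (fFunctional f)
    (fallIn x fun y => fexIn d fun n => fmem (opair n y) f)

/-- `x` is countable. -/
def fCountable (x : Name P) : Sent P := fEnumerable (check PSet.omega) x

/-- `x` is finite. -/
def fFinite (x : Name P) : Sent P := fexIn (check PSet.omega) fun k => fEnumerable k x

/-- `x` is a countable set of ordinals. -/
def fCountableSetOfOrdinals (x : Name P) : Sent P := fand (fCountable x) (fallIn x fOrd)

end Names

/-- The `P`-name for the value of the `Q`-name `y` under the filter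
`{q | ∃ p ∈ G, f p ≤ q}` that `f : P → Q` induces from the `P`-generic `G`. -/
def pull {P Q : Type u} [Preorder Q] (f : P → Q) : Name Q → Name P
  | .mk ι a c => .mk (Σ i : ι, {p : P // f p ≤ c i}) (fun x => pull f (a x.1)) (fun x => x.2.1)

/-! ## Two-step iterations -/

/-- The two-step iteration `Q * Ṙ`, where `Ṙ` is the `Q`-name of the set defined in the extension
by the formula `R`, ordered by reverse inclusion: the conditions are the pairs `(q, x)` with
`q ⊩ x ∈ Ṙ`. -/
structure Iter (Q : Type u) [Preorder Q] (R : Name Q → Sent Q) : Type (u + 1) where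
  fst : Q
  snd : Name Q
  forces : R snd fst

/-- `(q, x) ≤ (q', x')` iff `q ≤ q'` and `q ⊩ x ⊇ x'`. -/
instance (Q : Type u) [Preorder Q] (R : Name Q → Sent Q) : Preorder (Iter Q R) where
  le a b := a.fst ≤ b.fst ∧ fsub b.snd a.snd a.fst
  le_refl a := ⟨le_rfl, fun _ _ _ h => h⟩
  le_trans a b c hab hbc := ⟨hab.1.trans hbc.1, fun z r hr hz =>
    hab.2 z r hr (hbc.2 z r (hr.trans hab.1) hz)⟩

/-! ## The specializing forcing -/

/-- Finite partial functions from `X` to `Y`. -/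
@[ext]
structure FinPart (X : Type u) (Y : Type) : Type u where
  val : X → Option Y
  finite : {x | val x ≠ none}.Finite

/-- The domain of a finite partial function. -/
def FinPart.dom {X : Type u} {Y : Type} (p : FinPart X Y) : Set X := {x | p.val x ≠ none}

/-- The nowhere defined function. -/
def FinPart.empty (X : Type u) (Y : Type) : FinPart X Y := ⟨fun _ => none, by simp⟩

/-- The forcing `P(T)`: finite partial functions from `T` to `ω` that are injective on chains. -/
@[ext]
structure BMR (T : Type u) [PartialOrder T] : Type u where
  fn : FinPart T ℕ
  inj : ∀ s t : T, s < t → ∀ m n : ℕ, fn.val s = some m → fn.val t = some n → m ≠ n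

section Posets

variable {T : Type u} [PartialOrder T]

/-- Conditions are ordered by reverse inclusion. -/
instance : Preorder (BMR T) where
  le p q := ∀ t n, q.fn.val t = some n → p.fn.val t = some n
  le_refl _ _ _ h := h
  le_trans _ _ _ h h' t n hn := h t n (h' t n hn)

instance : OrderTop (BMR T) where
  top := ⟨FinPart.empty T ℕ, fun s t _ m n h => by simp [FinPart.empty] at h⟩
  le_top p t n h := by simp [FinPart.empty] at h

/-- The border `∂A`: the nodes outside `A` all of whose predecessors are in `A`. -/
def border (A : Set T) : Set T := {s | s ∉ A ∧ Set.Iio s ⊆ A}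

/-- The forcing `Q_A`: pairs of a stem in `P(T)` with domain included in `A` and a promise, a
finite partial function from `∂A` to the finite subsets of `ω`, such that no node of the domain
of the stem has a value that is promised to be avoided at a border node above it. -/
@[ext]
structure QA (A : Set T) : Type u where
  stem : BMR T
  promise : FinPart T (Finset ℕ)
  stem_dom : stem.fn.dom ⊆ A
  promise_dom : promise.dom ⊆ border A
  keep : ∀ t t' : T, ∀ F : Finset ℕ, ∀ n ∈ F, promise.val t' = some F → t ≤ t' →
    stem.fn.val t ≠ some n

instance (A : Set T) : Preorder (QA A) where
  le a b := a.stem ≤ b.stem ∧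
    ∀ t F, b.promise.val t = some F → ∃ F', a.promise.val t = some F' ∧ F ⊆ F'
  le_refl a := ⟨le_rfl, fun _ F h => ⟨F, h, subset_rfl⟩⟩
  le_trans a b c h h' := ⟨h.1.trans h'.1, fun t F hF => by
    obtain ⟨F', hF', h1⟩ := h'.2 t F hF
    obtain ⟨F'', hF'', h2⟩ := h.2 t F' hF'
    exact ⟨F'', hF'', h1.trans h2⟩⟩

instance (A : Set T) : OrderTop (QA A) where
  top := ⟨⊤, FinPart.empty T (Finset ℕ), fun t h => (h rfl).elim, fun t h => (h rfl).elim,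
    fun t t' F n _ h => by simp [FinPart.empty] at h⟩
  le_top a := ⟨le_top, fun t F h => by simp [FinPart.empty] at h⟩

/-! In the following definitions `code` presents the nodes of `T` as (pairwise different) sets. -/

/-- The canonical name of the pair `(t, n)`. -/
def nodePair {P : Type u} [Preorder P] [OrderTop P] (code : T → PSet.{u}) (t : T) (n : ℕ) :
    Name P :=
  opair (check (code t)) (check (PSet.ofNat n))

/-- The canonical name of the ground model set `B × ω`, for `B ⊆ T`. -/
def nodesTimesOmega {P : Type u} [Preorder P] [OrderTop P] (code : T → PSet.{u}) (B : Set T) :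
    Name P :=
  .mk (B × ℕ) (fun x => nodePair code x.1 x.2) (fun _ => ⊤)

/-- The canonical name of the ground model function `p ↾ B`. -/
def checkRestrict {P : Type u} [Preorder P] [OrderTop P] (code : T → PSet.{u})
    (p : BMR T) (B : Set T) : Name P :=
  .mk {x : T × ℕ // x.1 ∈ B ∧ p.fn.val x.1 = some x.2}
    (fun x => nodePair code x.1.1 x.1.2) (fun _ => ⊤)

/-- The canonical `P(T)`-name of `g_T ↾ B`, where `g_T` is the union of the generic filter. -/
def gName (code : T → PSet.{u}) (B : Set T) : Name (BMR T) :=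
  .mk {x : (T × ℕ) × BMR T // x.1.1 ∈ B ∧ x.2.fn.val x.1.1 = some x.1.2}
    (fun x => nodePair code x.1.1.1 x.1.1.2) (fun x => x.1.2)

/-- The canonical `Q_A`-name `ḣ` of the union of the stems of the conditions in the generic
filter. -/
def hName (code : T → PSet.{u}) (A : Set T) : Name (QA A) :=
  .mk {x : (T × ℕ) × QA A // x.2.stem.fn.val x.1.1 = some x.1.2}
    (fun x => nodePair code x.1.1.1 x.1.1.2) (fun x => x.1.2)

/-- `f` is a partial function from `B` to `ω`. -/
def fPartialFn {P : Type u} [Preorder P] [OrderTop P] (code : T → PSet.{u}) (B : Set T)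
    (f : Name P) : Sent P :=
  fand (fsub f (nodesTimesOmega code B)) (fFunctional f)

/-- `f` is a partial specializing function on `T`: a partial function from `T` to `ω` that is
injective on chains. -/
def fPartialSpec {P : Type u} [Preorder P] [OrderTop P] (code : T → PSet.{u}) (f : Name P) :
    Sent P :=
  fand (fPartialFn code Set.univ f)
    (fall fun x : {x : T × T // x.1 < x.2} => fall fun n : ℕ =>
      fnot (fand (fmem (nodePair code x.1.1 n) f) (fmem (nodePair code x.1.2 n) f)))

/-- The formula `x ∈ R(h)`: `x` is a finite partial function from `T \ A` to `ω` such that `x ∪ h`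
is a partial specializing function. -/
def fR (code : T → PSet.{u}) (A : Set T) (x : Name (QA A)) : Sent (QA A) :=
  fand (fand (fFinite x) (fPartialFn code Aᶜ x))
    (fPartialSpec code (union x (hName code A)))

end Posets

end SpecialTree

open SpecialTree

namespace SpecialTree

/-! ### Equality and membership in the forcing language -/

section Forcing

variable {P : Type u} [Preorder P]

/-! A condition `p` splits into its parts on `A` and off `A`. They interact only in that a value
used off `A` must be avoided below it. Every node outside `A` is above exactly one border node, so
finitely many promises at the border record this interaction: at `t`, the values of `p` on the cone
above `t` (`BMR.toQA`). These promises make `p.toQA A` force the part off `A` into the second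
forcing (`fR_toQA`).

Conversely, given `(q, x)` in the iteration, some extension of `q` decides the finite set `x`
(`exists_decide_finite`), and the decided set together with the stem is a condition of `P(T)`. Its
promises are then made true by using the promised values on the cones (`exists_toQA_le`), which are
infinite by normality. This is density (`embed_dense`), and the projection property follows from it.
`Q_A` is σ-centered because there are countably many stems and promises over one stem can be united.

For (2), `P(T)` has the countable chain condition: after thinning to a common root, an ultrafilter
argument finds two conditions whose remaining nodes are pairwise incomparable
(`exists_incomparable`). So countably many conditions decide a countable set of ordinals. Let `A`
contain their supports. Such a condition `w` satisfies `r ≤ w` iff `r.toQA A ≤ w.toQA A`, so its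
projection can replace it in a `Q_A`-name. -/

theorem feq_mono {x y : Name P} {p q : P} (hq : q ≤ p) (h : feq x y p) : feq x y q := by
  cases x; cases y
  exact ⟨fun i r hr => h.1 i r (hr.trans hq), fun j r hr => h.2 j r (hr.trans hq)⟩

/-- Each clause of `feq` is itself a density statement. Proofs of forced equalities may therefore
first pass to an extension that decides what is needed. -/
theorem feq_of_dense {x y : Name P} {p : P} (h : ∀ q ≤ p, ∃ r ≤ q, feq x y r) : feq x y p := by
  cases x; cases y
  refine ⟨fun i q hq hi => ?_, fun j q hq hj => ?_⟩
  · obtain ⟨r, hr, h'⟩ := h q hq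
    obtain ⟨s, hs, t⟩ := h'.1 i r le_rfl (hr.trans hi)
    exact ⟨s, hs.trans hr, t⟩
  · obtain ⟨r, hr, h'⟩ := h q hq
    obtain ⟨s, hs, t⟩ := h'.2 j r le_rfl (hr.trans hj)
    exact ⟨s, hs.trans hr, t⟩

theorem feq_refl (x : Name P) (p : P) : feq x x p := by
  induction x generalizing p with
  | mk ι a c ih =>
    exact ⟨fun i q _ hi => ⟨q, le_rfl, i, hi, ih i q⟩, fun i q _ hi => ⟨q, le_rfl, i, hi, ih i q⟩⟩

theorem feq_symm {x y : Name P} {p : P} (h : feq x y p) : feq y x p := by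
  induction x generalizing y p with
  | mk ι a c ih =>
    cases y with
    | mk κ b d =>
      refine ⟨fun j q hq hj => ?_, fun i q hq hi => ?_⟩
      · obtain ⟨r, hr, i, hi, e⟩ := h.2 j q hq hj
        exact ⟨r, hr, i, hi, ih i e⟩
      · obtain ⟨r, hr, j, hj, e⟩ := h.1 i q hq hi
        exact ⟨r, hr, j, hj, ih i e⟩

theorem feq_trans {x y z : Name P} {p : P} (h : feq x y p) (h' : feq y z p) : feq x z p := by
  induction x generalizing y z p with
  | mk ι a c ih =>
    cases y with
    | mk κ b d =>
      cases z with
      | mk μ e f =>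
        refine ⟨fun i q hq hi => ?_, fun k q hq hk => ?_⟩
        · obtain ⟨r, hr, j, hj, e₁⟩ := h.1 i q hq hi
          obtain ⟨s, hs, k, hk, e₂⟩ := h'.1 j r (hr.trans hq) hj
          exact ⟨s, hs.trans hr, k, hk, ih i (feq_mono hs e₁) e₂⟩
        · obtain ⟨r, hr, j, hj, e₁⟩ := h'.2 k q hq hk
          obtain ⟨s, hs, i, hi, e₂⟩ := h.2 j r (hr.trans hq) hj
          exact ⟨s, hs.trans hr, i, hi, ih i e₂ (feq_mono hs e₁)⟩

theorem fmem_mono {x y : Name P} {p q : P} (hq : q ≤ p) (h : fmem x y p) : fmem x y q := by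
  cases y
  exact fun r hr => h r (hr.trans hq)

theorem fmem_of_dense {x y : Name P} {p : P} (h : ∀ q ≤ p, ∃ r ≤ q, fmem x y r) :
    fmem x y p := by
  cases y
  intro q hq
  obtain ⟨r, hr, h'⟩ := h q hq
  obtain ⟨s, hs, t⟩ := h' r le_rfl
  exact ⟨s, hs.trans hr, t⟩

theorem fmem_mk {ι : Type u} {a : ι → Name P} {c : ι → P} {p : P} (i : ι) (h : p ≤ c i) :
    fmem (a i) (.mk ι a c) p :=
  fun q hq => ⟨q, le_rfl, i, hq.trans h, feq_refl _ _⟩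

theorem fmem_congr_left {x x' y : Name P} {p : P} (e : feq x x' p) (h : fmem x y p) :
    fmem x' y p := by
  cases y
  intro q hq
  obtain ⟨r, hr, j, hj, e'⟩ := h q hq
  exact ⟨r, hr, j, hj, feq_trans (feq_symm (feq_mono (hr.trans hq) e)) e'⟩

theorem fmem_congr_right {x y y' : Name P} {p : P} (e : feq y y' p) (h : fmem x y p) :
    fmem x y' p := by
  cases y; cases y'
  intro q hq
  obtain ⟨r, hr, j, hj, e'⟩ := h q hq
  obtain ⟨s, hs, k, hk, e''⟩ := e.1 j r (hr.trans hq) hj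
  exact ⟨s, hs.trans hr, k, hk, feq_trans (feq_mono hs e') e''⟩

theorem feq_of_fsub {x y : Name P} {p : P} (h : fsub x y p) (h' : fsub y x p) : feq x y p := by
  cases x with
  | mk ι a c =>
    cases y with
    | mk κ b d =>
      refine ⟨fun i q hq hi => h _ q hq (fmem_mk i hi) q le_rfl, fun j q hq hj => ?_⟩
      obtain ⟨r, hr, i, hi, e⟩ := h' _ q hq (fmem_mk j hj) q le_rfl
      exact ⟨r, hr, i, hi, feq_symm e⟩

/-- To show `x ⊆ y` it suffices to consider the elements listed in the name `x`. -/
theorem fsub_mk {ι : Type u} {a : ι → Name P} {c : ι → P} {y : Name P} {p : P}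
    (h : ∀ i, ∀ q ≤ p, q ≤ c i → fmem (a i) y q) : fsub (.mk ι a c) y p := by
  intro z q hq hz
  refine fmem_of_dense fun r hr => ?_
  obtain ⟨s, hs, i, hi, e⟩ := hz r hr
  exact ⟨s, hs, fmem_congr_left (feq_symm e) (h i s (hs.trans (hr.trans hq)) hi)⟩

theorem fsub_mono {x y : Name P} {p q : P} (hq : q ≤ p) (h : fsub x y p) : fsub x y q :=
  fun z r hr => h z r (hr.trans hq)

theorem fOrd_mono {x : Name P} {p q : P} (hq : q ≤ p) (h : fOrd x p) : fOrd x q :=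
  ⟨fun z r hr => h.1 z r (hr.trans hq), fun z r hr => h.2 z r (hr.trans hq)⟩

theorem fOrd_of_fmem {x y : Name P} {p : P} (h : fOrd x p) (hy : fmem y x p) : fOrd y p :=
  ⟨h.2 y p le_rfl hy, fun z q hq hz =>
    h.2 z q hq (h.1 y q hq (fmem_mono hq hy) z q le_rfl hz)⟩

/-- Every condition that does not force `x ∈ y` has an extension that forces `x ∉ y`. -/
theorem exists_fnot_fmem {x y : Name P} {p : P} (h : ¬ fmem x y p) :
    ∃ q ≤ p, fnot (fmem x y) q := by
  by_contra! hc
  refine h (fmem_of_dense fun q hq => ?_)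
  have := hc q hq
  simp only [fnot, not_forall, not_not] at this
  obtain ⟨r, hr, h'⟩ := this
  exact ⟨r, hr, h'⟩

end Forcing

/-! ### Ordered pairs in the forcing language -/

section Pairs

variable {P : Type u} [Preorder P] [OrderTop P]

theorem fmem_upair_left (x y : Name P) (p : P) : fmem x (upair x y) p := by
  have := fmem_mk (P := P) (ι := ULift Bool) (a := fun b => if b.down then x else y)
    (c := fun _ => ⊤) (p := p) ⟨true⟩ le_top
  simpa [upair] using this

theorem fmem_upair_right (x y : Name P) (p : P) : fmem y (upair x y) p := by
  have := fmem_mk (P := P) (ι := ULift Bool) (a := fun b => if b.down then x else y)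
    (c := fun _ => ⊤) (p := p) ⟨false⟩ le_top
  simpa [upair] using this

theorem exists_of_fmem_upair {x y z : Name P} {p : P} (h : fmem z (upair x y) p) :
    ∃ r ≤ p, feq z x r ∨ feq z y r := by
  obtain ⟨r, hr, ⟨b⟩, -, e⟩ := h p le_rfl
  cases b
  · exact ⟨r, hr, .inr (by simpa using e)⟩
  · exact ⟨r, hr, .inl (by simpa using e)⟩

theorem feq_of_fmem_upair_self {x z : Name P} {p : P} (h : fmem z (upair x x) p) :
    feq z x p :=
  feq_of_dense fun q hq => by
    obtain ⟨r, hr, e⟩ := exists_of_fmem_upair (fmem_mono hq h)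
    exact ⟨r, hr, e.elim id id⟩

theorem upair_fsub {x y z : Name P} {p : P} (hx : fmem x z p) (hy : fmem y z p) :
    fsub (upair x y) z p := by
  refine fsub_mk fun b q hq _ => ?_
  cases b with
  | up b => cases b
            · simpa using fmem_mono hq hy
            · simpa using fmem_mono hq hx

theorem upair_congr {x x' y y' : Name P} {p : P} (hx : feq x x' p) (hy : feq y y' p) :
    feq (upair x y) (upair x' y') p :=
  feq_of_fsub
    (upair_fsub (fmem_congr_left (feq_symm hx) (fmem_upair_left _ _ _))
      (fmem_congr_left (feq_symm hy) (fmem_upair_right _ _ _)))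
    (upair_fsub (fmem_congr_left hx (fmem_upair_left _ _ _))
      (fmem_congr_left hy (fmem_upair_right _ _ _)))

theorem opair_congr {x x' y y' : Name P} {p : P} (hx : feq x x' p) (hy : feq y y' p) :
    feq (opair x y) (opair x' y') p :=
  upair_congr (upair_congr hx hx) (upair_congr hx hy)

theorem feq_fst_of_feq_opair {x y z w : Name P} {p : P} (h : feq (opair x y) (opair z w) p) :
    feq x z p := by
  refine feq_of_dense fun q hq => ?_
  obtain ⟨r, hr, e | e⟩ := exists_of_fmem_upair
    (fmem_congr_right (feq_mono hq h) (fmem_upair_left _ _ _))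
  · exact ⟨r, hr, feq_of_fmem_upair_self (fmem_congr_right e (fmem_upair_left _ _ _))⟩
  · exact ⟨r, hr, feq_symm (feq_of_fmem_upair_self
      (fmem_congr_right (feq_symm e) (fmem_upair_left _ _ _)))⟩

/-- The degenerate case of Kuratowski's pair is a second coordinate equal to the first, where `{x,
y}` collapses; `key` settles it by comparing `{z, w}` with the collapsed pair. All other cases
reduce to it or give `y = w` at once. -/
theorem feq_snd_of_feq_opair {x y z w : Name P} {p : P} (h : feq (opair x y) (opair z w) p) :
    feq y w p := by
  have hxz := feq_fst_of_feq_opair h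
  refine feq_of_dense fun q hq => ?_
  -- if `y = x` is forced then so is `y = w`
  have key : ∀ r ≤ q, feq y x r → ∃ s ≤ r, feq y w s := fun r hr e => by
    obtain ⟨s, hs, e'⟩ := exists_of_fmem_upair (fmem_congr_right
      (feq_symm (feq_mono (hr.trans hq) h)) (fmem_upair_right (upair z z) (upair z w) r))
    refine ⟨s, hs, ?_⟩
    have hyx := feq_mono hs e
    rcases e' with e' | e'
    · exact feq_symm (feq_trans (feq_of_fmem_upair_self
        (fmem_congr_right e' (fmem_upair_right _ _ _))) (feq_symm hyx))
    · exact feq_symm (feq_of_fmem_upair_self (fmem_congr_right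
        (feq_trans e' (upair_congr (feq_symm hyx) (feq_refl _ _))) (fmem_upair_right _ _ _)))
  obtain ⟨r, hr, e⟩ := exists_of_fmem_upair
    (fmem_congr_right (feq_mono hq h) (fmem_upair_right (upair x x) (upair x y) q))
  rcases e with e | e
  · obtain ⟨s, hs, h'⟩ := key r hr (feq_trans (feq_of_fmem_upair_self
      (fmem_congr_right e (fmem_upair_right _ _ _))) (feq_symm (feq_mono (hr.trans hq) hxz)))
    exact ⟨s, hs.trans hr, h'⟩
  · obtain ⟨s, hs, e' | e'⟩ := exists_of_fmem_upair (fmem_congr_right e (fmem_upair_right _ _ _))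
    · obtain ⟨t, ht, h'⟩ := key s (hs.trans hr)
        (feq_trans e' (feq_symm (feq_mono (hs.trans (hr.trans hq)) hxz)))
      exact ⟨t, ht.trans (hs.trans hr), h'⟩
    · exact ⟨s, hs.trans hr, e'⟩

end Pairs

/-! ### Names of ground model sets, and ordinals -/

section Check

variable {P : Type u} [Preorder P] [OrderTop P]

theorem feq_check {x y : PSet.{u}} (h : PSet.Equiv x y) (p : P) :
    feq (check x) (check y) p := by
  induction x generalizing y p with
  | mk ι a ih =>
    cases y with
    | mk κ b =>
      refine ⟨fun i q _ _ => ?_, fun j q _ _ => ?_⟩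
      · obtain ⟨j, hj⟩ := h.1 i
        exact ⟨q, le_rfl, j, le_top, ih i hj q⟩
      · obtain ⟨i, hi⟩ := h.2 j
        exact ⟨q, le_rfl, i, le_top, ih i hi q⟩

/-- All entries of a check name carry `⊤`, so a single condition forcing the equality already
reveals the ground model matching. -/
theorem equiv_of_feq_check {x y : PSet.{u}} {p : P} (h : feq (check x) (check y) p) :
    PSet.Equiv x y := by
  induction x generalizing y p with
  | mk ι a ih =>
    cases y with
    | mk κ b =>
      refine ⟨fun i => ?_, fun j => ?_⟩
      · obtain ⟨r, -, j, -, e⟩ := h.1 i p le_rfl le_top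
        exact ⟨j, ih i e⟩
      · obtain ⟨r, -, i, -, e⟩ := h.2 j p le_rfl le_top
        exact ⟨i, ih i e⟩

theorem fmem_check {x y : PSet.{u}} (h : x ∈ y) (p : P) : fmem (check x) (check y) p := by
  cases y with
  | mk κ b =>
    obtain ⟨j, hj⟩ := h
    exact fun q _ => ⟨q, le_rfl, j, le_top, feq_check hj q⟩

theorem exists_of_fmem_check {y : PSet.{u}} {z : Name P} {p : P} (h : fmem z (check y) p) :
    ∃ r ≤ p, ∃ x ∈ y, feq z (check x) r := by
  cases y with
  | mk κ b =>
    obtain ⟨r, hr, j, -, e⟩ := h p le_rfl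
    exact ⟨r, hr, b j, PSet.Mem.mk b j, e⟩

theorem mem_ofNat_iff {x : PSet.{u}} {n : ℕ} :
    x ∈ PSet.ofNat.{u} n ↔ ∃ i < n, PSet.Equiv x (PSet.ofNat.{u} i) := by
  induction n with
  | zero => simp [PSet.ofNat]
  | succ n ih =>
    rw [PSet.ofNat, PSet.mem_insert_iff, ih]
    constructor
    · rintro (h | ⟨i, hi, h⟩)
      · exact ⟨n, by omega, h⟩
      · exact ⟨i, by omega, h⟩
    · rintro ⟨i, hi, h⟩
      rcases Nat.lt_succ_iff_lt_or_eq.1 hi with hi | rfl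
      · exact .inr ⟨i, hi, h⟩
      · exact .inl h

theorem ofNat_injective {m n : ℕ} (h : PSet.Equiv (PSet.ofNat.{u} m) (PSet.ofNat.{u} n)) :
    m = n := by
  have key : ∀ {m n : ℕ}, m < n → ¬ PSet.Equiv (PSet.ofNat.{u} m) (PSet.ofNat.{u} n) :=
    fun hmn h => PSet.mem_irrefl (PSet.ofNat.{u} _)
      ((PSet.Mem.congr_right h).2 (mem_ofNat_iff.2 ⟨_, hmn, PSet.Equiv.refl _⟩))
  rcases lt_trichotomy m n with hmn | rfl | hmn
  · exact (key hmn h).elim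
  · rfl
  · exact (key hmn h.symm).elim

theorem exists_of_fmem_check_ofNat {n : ℕ} {z : Name P} {p : P}
    (h : fmem z (check (PSet.ofNat.{u} n)) p) :
    ∃ r ≤ p, ∃ i < n, feq z (check (PSet.ofNat.{u} i)) r := by
  obtain ⟨r, hr, x, hx, e⟩ := exists_of_fmem_check h
  obtain ⟨i, hi, e'⟩ := mem_ofNat_iff.1 hx
  exact ⟨r, hr, i, hi, feq_trans e (feq_check e' r)⟩

theorem exists_of_fmem_check_omega {z : Name P} {p : P} (h : fmem z (check PSet.omega.{u}) p) :
    ∃ r ≤ p, ∃ i : ℕ, feq z (check (PSet.ofNat.{u} i)) r := by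
  obtain ⟨r, hr, ⟨i⟩, -, e⟩ := h p le_rfl
  exact ⟨r, hr, i, e⟩

theorem fmem_check_omega (n : ℕ) (p : P) :
    fmem (check (PSet.ofNat.{u} n)) (check PSet.omega.{u}) p :=
  fmem_check (PSet.Mem.mk (fun n : ULift ℕ => PSet.ofNat.{u} n.down) ⟨n⟩) p

theorem toPSet_injective {α β : Ordinal.{u}} (h : PSet.Equiv α.toPSet β.toPSet) : α = β := by
  rw [← Ordinal.rank_toPSet α, ← Ordinal.rank_toPSet β]
  exact PSet.rank_congr h

/-- Forcing adds no ordinals. -/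
theorem exists_feq_check_of_fOrd {x : Name P} {p : P} (h : fOrd x p) :
    ∃ r ≤ p, ∃ α : Ordinal.{u}, feq x (check α.toPSet) r := by
  induction x generalizing p with
  | mk ι a c ih =>
    set x : Name P := .mk ι a c with hx
    -- some ordinal is forced out of `x` by an extension of `p`
    have hex : ∃ α : Ordinal.{u}, ∃ q ≤ p, fnot (fmem (check α.toPSet) x) q := by
      by_contra! hc
      have hall : ∀ α : Ordinal.{u}, ∃ ri : P × ι, feq (check α.toPSet) (a ri.2) ri.1 := by
        intro α
        have := hc α p le_rfl
        simp only [fnot, not_forall, not_not] at this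
        obtain ⟨q, _, hm⟩ := this
        obtain ⟨r, -, i, -, e⟩ := hm q le_rfl
        exact ⟨(r, i), e⟩
      -- Otherwise every ordinal is matched with an element of `P × ι`. Ordinals sharing a match
      -- would be forced equal, so the ordinals of the universe would inject into a small type.
      choose f hf using hall
      refine not_injective_of_ordinal f fun α β e => ?_
      have h1 := hf α
      have h2 := hf β
      rw [← e] at h2
      exact toPSet_injective (equiv_of_feq_check (feq_trans h1 (feq_symm h2)))
    -- Below `q`, the name equals the least `α` that can be forced out of it: an element `β ≥ α` of
    -- `x` would put `α` into the transitive set `x`, and each `β < α` is in `x` by minimality.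
    obtain ⟨α, ⟨q, hq, hout⟩, hmin⟩ := WellFounded.has_min (wellFounded_lt (α := Ordinal.{u}))
      {α | ∃ q ≤ p, fnot (fmem (check α.toPSet) x) q} hex
    refine ⟨q, hq, α, feq_of_fsub (fsub_mk fun i r hr hi => ?_) fun z r hr hz => ?_⟩
    · refine fmem_of_dense fun s hs => ?_
      have hsq := hs.trans hr
      have hmem : fmem (a i) x s := fmem_mk i (hs.trans hi)
      obtain ⟨t, ht, β, e⟩ := ih i (fOrd_of_fmem (fOrd_mono (hsq.trans hq) h) hmem)
      refine ⟨t, ht, fmem_congr_left (feq_symm e) (fmem_check ?_ t)⟩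
      have hβx := fmem_congr_left e (fmem_mono ht hmem)
      refine Ordinal.mem_toPSet_iff.2 ⟨β, ?_, PSet.Equiv.refl _⟩
      by_contra! hle
      refine hout t (ht.trans hsq) ?_
      rcases hle.eq_or_lt with rfl | hlt
      · exact hβx
      · exact h.1 _ t (ht.trans (hsq.trans hq)) hβx _ t le_rfl
          (fmem_check (Ordinal.mem_toPSet_iff.2 ⟨α, hlt, PSet.Equiv.refl _⟩) t)
    · refine fmem_of_dense fun s hs => ?_
      obtain ⟨t, ht, y, hy, e⟩ := exists_of_fmem_check (fmem_mono hs hz)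
      obtain ⟨β, hβ, e'⟩ := Ordinal.mem_toPSet_iff.1 hy
      refine ⟨t, ht, fmem_congr_left (feq_symm (feq_trans e (feq_check e' t))) ?_⟩
      by_contra hn
      obtain ⟨w, hw, hw'⟩ := exists_fnot_fmem hn
      exact hmin β ⟨w, hw.trans (ht.trans (hs.trans (hr.trans hq))), hw'⟩ hβ

end Check

/-! ### Evaluating names under the induced filter -/

section Pull

variable {P Q : Type u} [Preorder P] [OrderTop P] [Preorder Q] [OrderTop Q] (f : P → Q)

/-- The pullback lists an element once for each condition projecting below its weight. As the weight
is `⊤`, the copy indexed by the current condition is always available. -/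
theorem feq_pull_check (x : PSet.{u}) (p : P) : feq (pull f (check x)) (check x) p := by
  induction x generalizing p with
  | mk ι a ih =>
    exact ⟨fun i q _ _ => ⟨q, le_rfl, i.1, le_top, ih i.1 q⟩,
      fun i q _ _ => ⟨q, le_rfl, ⟨i, q, le_top⟩, le_rfl, ih i q⟩⟩

theorem feq_pull_upair {x y : Name Q} {x' y' : Name P} {p : P} (hx : feq (pull f x) x' p)
    (hy : feq (pull f y) y' p) : feq (pull f (upair x y)) (upair x' y') p := by
  have key : ∀ b : Bool, feq (pull f (if b then x else y)) (if b then x' else y') p := fun b => by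
    cases b
    · simpa using hy
    · simpa using hx
  exact ⟨fun i q hq _ => ⟨q, le_rfl, i.1, le_top, feq_mono hq (key i.1.down)⟩,
    fun i q hq _ => ⟨q, le_rfl, ⟨i, q, le_top⟩, le_rfl, feq_mono hq (key i.down)⟩⟩

theorem feq_pull_opair {x y : Name Q} {x' y' : Name P} {p : P} (hx : feq (pull f x) x' p)
    (hy : feq (pull f y) y' p) : feq (pull f (opair x y)) (opair x' y') p :=
  feq_pull_upair f (feq_pull_upair f hx hx) (feq_pull_upair f hx hy)

end Pull

/-! ### Trees, borders and incomparable tuples -/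

section Tree

variable {T : Type u} [PartialOrder T] [IsTreeOrder T]

theorem le_total_of_le {a b t : T} (ha : a ≤ t) (hb : b ≤ t) : a ≤ b ∨ b ≤ a := by
  rcases ha.eq_or_lt with rfl | ha
  · exact .inr hb
  rcases hb.eq_or_lt with rfl | hb
  · exact .inl ha.le
  have := IsTreeOrder.wellOrder t
  rcases trichotomous_of (α := Set.Iio t) (· < ·) ⟨a, ha⟩ ⟨b, hb⟩ with h | h | h
  · exact .inl (le_of_lt h)
  · exact .inl (congrArg Subtype.val h).le
  · exact .inr (le_of_lt h)

theorem ht_mono {s t : T} (h : s ≤ t) : ht s ≤ ht t := by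
  have := IsTreeOrder.wellOrder s
  have := IsTreeOrder.wellOrder t
  exact Ordinal.type_le_iff'.2 ⟨⟨⟨Set.inclusion (Set.Iio_subset_Iio h),
    Set.inclusion_injective _⟩, Iff.rfl⟩⟩

theorem exists_ht_eq {t : T} {α : Ordinal.{u}} (h : α < ht t) : ∃ s < t, ht s = α := by
  have := IsTreeOrder.wellOrder t
  obtain ⟨s, hs⟩ := Ordinal.typein_surj (fun a b : Set.Iio t => a < b) h
  refine ⟨s.1, s.2, ?_⟩
  rw [← hs]
  have := IsTreeOrder.wellOrder s.1
  refine Ordinal.type_eq.2 ⟨⟨⟨fun x => ⟨⟨x.1, lt_trans x.2 s.2⟩, x.2⟩,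
    fun x => ⟨x.1.1, x.2⟩, fun _ => rfl, fun _ => rfl⟩, Iff.rfl⟩⟩

/-- The border node below a node outside of `A`. -/
theorem exists_border_le {A : Set T} {s : T} (hs : s ∉ A) : ∃ t ∈ border A, t ≤ s := by
  by_cases h : Set.Iio s ⊆ A
  · exact ⟨s, ⟨hs, h⟩, le_rfl⟩
  obtain ⟨u, hu, huA⟩ := Set.not_subset.1 h
  have := IsTreeOrder.wellOrder s
  obtain ⟨t, htA, hmin⟩ := (IsWellFounded.wf (r := fun a b : Set.Iio s => a < b)).has_min
    {v | v.1 ∉ A} ⟨⟨u, hu⟩, huA⟩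
  refine ⟨t.1, ⟨htA, fun v hv => ?_⟩, le_of_lt t.2⟩
  by_contra hvA
  exact hmin ⟨v, lt_trans hv t.2⟩ hvA hv

/-- Nodes below a common node are comparable, and a strict predecessor of a border node is in `A`.
Hence the cones over the border are disjoint, which keeps promises finite. -/
theorem border_eq_of_le {A : Set T} {a b s : T} (ha : a ∈ border A) (hb : b ∈ border A)
    (has : a ≤ s) (hbs : b ≤ s) : a = b := by
  rcases le_total_of_le has hbs with h | h
  · exact h.eq_or_lt.resolve_right fun h => ha.1 (hb.2 h)
  · exact (h.eq_or_lt.resolve_right fun h => hb.1 (ha.2 h)).symm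

theorem le_border {A : Set T} (hA : IsLowerSet A) {t b s : T} (ht : t ∈ A) (hb : b ∈ border A)
    (hbs : b ≤ s) (hts : t ≤ s) : t ≤ b :=
  (le_total_of_le hts hbs).resolve_right fun h => hb.1 (hA h ht)

namespace IsGenAronszajn

theorem ht_lt (hT : IsGenAronszajn T) (t : T) : ht t < Ordinal.omega 1 := by
  have hemp : lev T (Ordinal.omega 1) = ∅ := hT.height.1
  by_contra! h
  rcases h.eq_or_lt with h | h
  · exact (Set.ext_iff.1 hemp t).1 h.symm
  · obtain ⟨s, -, hs⟩ := exists_ht_eq h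
    exact (Set.ext_iff.1 hemp s).1 hs

theorem countable_Iic (hT : IsGenAronszajn T) (t : T) : (Set.Iic t).Countable := by
  have : (Set.Iio t).Countable := by
    rw [← Cardinal.le_aleph0_iff_set_countable, ← Order.lt_succ_iff, Cardinal.succ_aleph0]
    have h := hT.ht_lt t
    rw [← Cardinal.ord_aleph, Cardinal.lt_ord] at h
    simpa [ht] using h
  exact (this.insert t).mono fun s hs => (Set.mem_Iic.1 hs).eq_or_lt

/-- By normality `t` is comparable with a node on each level `ht t + n + 1`, and that node must be
above it. This leaves room for new values on every cone. -/
theorem infinite_Ici (hT : IsGenAronszajn T) (t : T) : (Set.Ici t).Infinite := by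
  have hlev : ∀ n : ℕ, ht t + (n + 1 : ℕ) < Ordinal.omega 1 := fun n =>
    Ordinal.isPrincipal_add_omega 1 (hT.ht_lt t)
      ((Ordinal.natCast_lt_omega0 _).trans Ordinal.omega0_lt_omega_one)
  choose f hf hcomp using fun n => hT.normal.comparable t _ (hlev n)
  have hf' : ∀ n, ht (f n) = ht t + (n + 1 : ℕ) := hf
  refine Set.infinite_of_injective_forall_mem (f := f) (fun m n h => ?_) fun n => ?_
  · have := hf' m
    rw [h, hf' n] at this
    have := add_left_cancel this
    have : n + 1 = m + 1 := by exact_mod_cast this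
    omega
  · refine (hcomp n).resolve_left fun h => ?_
    have := ht_mono h
    rw [hf' n] at this
    simp at this

theorem countable_of_isChain (hT : IsGenAronszajn T) {c : Set T} (hc : IsChain (· ≤ ·) c) :
    c.Countable := by
  obtain ⟨m, hm, hcm⟩ := IsChain.exists_maxChain hc
  exact (hT.branch m hm).mono hcm

/-- An uncountable family of `n`-tuples, each node occurring in countably many of them, contains
two tuples with no comparable entries. -/
theorem exists_incomparable (hT : IsGenAronszajn T) {W : Type u} [Uncountable W] {n : ℕ}
    (a : W → Fin n → T)
    (ha : ∀ k t, {w | a w k = t}.Countable) :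
    ∃ v w, v ≠ w ∧ ∀ j k, ¬ (a v j ≤ a w k ∨ a w k ≤ a v j) := by
  by_contra! hcon
  have : (Filter.cocountable : Filter W).NeBot := by
    refine ⟨fun h => ?_⟩
    have : (∅ : Set W) ∈ (Filter.cocountable : Filter W) := h ▸ Filter.mem_bot
    rw [Filter.mem_cocountable, Set.compl_empty] at this
    exact Set.not_countable_univ this
  -- Only finite partitions are split, so `D` needs no completeness beyond containing the
  -- cocountable sets.
  let D : Ultrafilter W := Ultrafilter.of Filter.cocountable
  have hD : ∀ s : Set W, s.Countable → sᶜ ∈ D := fun s hs =>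
    Ultrafilter.of_le _ (Filter.mem_cocountable.2 (by simpa using hs))
  have hav : ∀ k (C : Set T), C.Countable → {w | a w k ∉ C} ∈ D := fun k C hC => by
    have := hD (⋃ t ∈ C, {w | a w k = t}) (hC.biUnion fun t _ => ha k t)
    filter_upwards [this] with w hw hwC
    exact hw (Set.mem_biUnion hwC rfl)
  let Y : T → Fin n → Set W := fun x k => {w | x ≤ a w k ∨ a w k ≤ x}
  have hY : ∀ v, ∃ jk : Fin n × Fin n, Y (a v jk.1) jk.2 ∈ D := fun v => by
    have h : (⋃ jk ∈ (Set.univ : Set (Fin n × Fin n)), Y (a v jk.1) jk.2) ∈ D := by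
      filter_upwards [hD {v} (Set.countable_singleton v)] with w hw
      obtain ⟨j, k, hjk⟩ := hcon v w (fun h => hw h.symm)
      exact Set.mem_biUnion (x := (j, k)) (Set.mem_univ _) hjk
    obtain ⟨jk, -, h⟩ := (Ultrafilter.finite_biUnion_mem_iff Set.finite_univ).1 h
    exact ⟨jk, h⟩
  choose g hg using hY
  obtain ⟨⟨j, k⟩, hjk⟩ : ∃ jk, g ⁻¹' {jk} ∈ D := by
    have h : (⋃ jk ∈ (Set.univ : Set (Fin n × Fin n)), g ⁻¹' {jk}) ∈ D := by
      filter_upwards with w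
      exact Set.mem_biUnion (Set.mem_univ (g w)) rfl
    obtain ⟨jk, -, h⟩ := (Ultrafilter.finite_biUnion_mem_iff Set.finite_univ).1 h
    exact ⟨jk, h⟩
  have hg' : ∀ v ∈ g ⁻¹' {(j, k)}, Y (a v j) k ∈ D := fun v hv => by
    have := hg v
    rwa [show g v = (j, k) from hv] at this
  -- For two such `v`, `w`, some `z` has its `k`-th entry comparable with both `j`-th entries but
  -- below neither, as the latter excludes only countably many `z`. Both entries are then below it,
  -- hence comparable.
  have hchain : IsChain (· ≤ ·) ((fun v => a v j) '' (g ⁻¹' {(j, k)})) := by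
    rintro _ ⟨v, hv, rfl⟩ _ ⟨w, hw, rfl⟩ -
    obtain ⟨z, ⟨⟨hz1, hz2⟩, hz3⟩, hz4⟩ := D.nonempty_of_mem (Filter.inter_mem (Filter.inter_mem
      (Filter.inter_mem (hg' v hv) (hg' w hw)) (hav k _ (hT.countable_Iic (a v j))))
      (hav k _ (hT.countable_Iic (a w j))))
    exact le_total_of_le (hz1.resolve_right hz3) (hz2.resolve_right hz4)
  -- The chain is countable, so `D`-almost every `j`-th entry avoids it, yet `D`-almost every one
  -- belongs to it.
  obtain ⟨v, hv1, hv2⟩ := D.nonempty_of_mem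
    (Filter.inter_mem hjk (hav j _ (hT.countable_of_isChain hchain)))
  exact hv2 (Set.mem_image_of_mem _ hv1)

end IsGenAronszajn

end Tree

/-! ### The countable chain condition -/

section CCC

theorem exists_uncountable_fiber {α β : Type*} [Countable β] {s : Set α} (hs : ¬ s.Countable)
    (f : α → β) : ∃ b, ¬ {a ∈ s | f a = b}.Countable := by
  by_contra! h
  have hsub : s ⊆ ⋃ b, {a ∈ s | f a = b} := fun a ha => Set.mem_iUnion.2 ⟨f a, ha, rfl⟩
  exact hs ((Set.countable_iUnion h).mono hsub)

/-- A family of finite sets of the same size has an uncountable subfamily whose members all contain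
a finite set `R` such that every other point is in countably many of them. -/
theorem exists_root {α X : Type*} [DecidableEq X] {s : Set α} (hs : ¬ s.Countable)
    (d : α → Finset X) (n : ℕ) (hd : ∀ a ∈ s, (d a).card = n) :
    ∃ R : Finset X, ¬ {a ∈ s | R ⊆ d a}.Countable ∧
      ∀ x ∉ R, {a ∈ s | R ⊆ d a ∧ x ∈ d a}.Countable := by
  -- Take `R` of maximal size inside uncountably many members; another point in uncountably many of
  -- these could be added to `R`.
  let K : Set ℕ := {k | ∃ R : Finset X, R.card = k ∧ ¬ {a ∈ s | R ⊆ d a}.Countable}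
  have hK : K.Nonempty := ⟨0, ∅, rfl, by simpa using hs⟩
  have hbd : BddAbove K := ⟨n, fun k ⟨R, hR, hc⟩ => by
    obtain ⟨a, ha, hRa⟩ : {a ∈ s | R ⊆ d a}.Nonempty := by
      by_contra h
      rw [Set.not_nonempty_iff_eq_empty] at h
      exact hc (h ▸ Set.countable_empty)
    rw [← hR, ← hd a ha]
    exact Finset.card_le_card hRa⟩
  obtain ⟨R, hR, hc⟩ := Nat.sSup_mem hK hbd
  refine ⟨R, hc, fun x hx => ?_⟩
  by_contra hxc
  have : (insert x R).card ∈ K := ⟨_, rfl, by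
    simpa [Finset.insert_subset_iff, and_comm] using hxc⟩
  have := le_csSup hbd this
  rw [Finset.card_insert_of_notMem hx, hR] at this
  omega

variable {T : Type u} [PartialOrder T]

/-- The domain of a condition as a finite set. -/
noncomputable def BMR.support (p : BMR T) : Finset T := p.fn.finite.toFinset

theorem BMR.mem_support {p : BMR T} {t : T} : t ∈ p.support ↔ ∃ n, p.fn.val t = some n := by
  simp [BMR.support, Option.ne_none_iff_exists']

/-- Two conditions without conflicting values are compatible. -/
theorem BMR.compat_of {p q : BMR T} (h : ∀ t m n, p.fn.val t = some m → q.fn.val t = some n → m = n)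
    (h' : ∀ s t m n, s < t ∨ t < s → p.fn.val s = some m → q.fn.val t = some n → m ≠ n) :
    Compat p q := by
  have hval : ∀ t n, ((p.fn.val t).or (q.fn.val t)) = some n →
      p.fn.val t = some n ∨ q.fn.val t = some n := fun t n ht => by
    cases hp : p.fn.val t <;> simp_all
  refine ⟨⟨⟨fun t => (p.fn.val t).or (q.fn.val t), ?_⟩, ?_⟩, ?_, ?_⟩
  · refine (p.fn.finite.union q.fn.finite).subset fun t ht => ?_
    by_contra hc
    simp_all
  · intro s t hst m n hs ht
    rcases hval s m hs with hs | hs <;> rcases hval t n ht with ht | ht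
    · exact p.inj s t hst m n hs ht
    · exact h' s t m n (.inl hst) hs ht
    · exact (h' t s n m (.inr hst) ht hs).symm
    · exact q.inj s t hst m n hs ht
  · intro t n ht
    simp [ht]
  · intro t n ht
    cases hp : p.fn.val t with
    | none => simp [hp, ht]
    | some m => simp [hp, h t m n hp ht]

/-- The forcing that specializes a tree without uncountable branches satisfies the countable
chain condition. -/
theorem IsGenAronszajn.countable_of_antichain [IsTreeOrder T] (hT : IsGenAronszajn T)
    {W : Set (BMR T)} (hW : ∀ p ∈ W, ∀ q ∈ W, p ≠ q → ¬ Compat p q) : W.Countable := by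
  classical
  by_contra hunc
  obtain ⟨n, hn⟩ := exists_uncountable_fiber hunc fun p : BMR T => p.support.card
  obtain ⟨R, hR, hRx⟩ := exists_root hn BMR.support n fun p hp => hp.2
  obtain ⟨v, hv⟩ := exists_uncountable_fiber hR fun (p : BMR T) (t : R) => p.fn.val t
  set W' := {p ∈ {p ∈ {p ∈ W | p.support.card = n} | R ⊆ p.support} |
    (fun t : R => p.fn.val t) = v}
  have hcard : ∀ p : W', (p.1.support \ R).card = n - R.card := fun p => by
    rw [Finset.card_sdiff_of_subset p.2.1.2, p.2.1.1.2]
  let a : W' → Fin (n - R.card) → T := fun p k =>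
    ((p.1.support \ R).equivFinOfCardEq (hcard p)).symm k
  have ha : ∀ p k, a p k ∈ p.1.support \ R := fun p k => Subtype.prop _
  have ha' : ∀ p : W', ∀ t ∈ p.1.support \ R, ∃ k, a p k = t := fun p t ht =>
    ⟨(p.1.support \ R).equivFinOfCardEq (hcard p) ⟨t, ht⟩, by simp [a]⟩
  have : Uncountable W' := by rwa [← not_countable_iff, Set.countable_coe_iff]
  obtain ⟨p, q, hpq, hinc⟩ := hT.exists_incomparable a fun k t => by
    by_cases ht : t ∈ R
    · refine Set.countable_empty.mono fun p hp => ?_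
      exact (Finset.mem_sdiff.1 (ha p k)).2 (hp ▸ ht)
    · refine Set.Countable.mono (fun p hp => ?_)
        ((hRx t ht).preimage (f := Subtype.val (p := (· ∈ W'))) Subtype.val_injective)
      exact ⟨p.2.1.1, p.2.1.2, hp ▸ (Finset.mem_sdiff.1 (ha p k)).1⟩
  have hroot : ∀ t ∈ R, p.1.fn.val t = q.1.fn.val t := fun t ht =>
    congrFun (p.2.2.trans q.2.2.symm) ⟨t, ht⟩
  -- comparable nodes in the domains lie in the root
  have hcomp : ∀ s t m k, (s ≤ t ∨ t ≤ s) → p.1.fn.val s = some m → q.1.fn.val t = some k →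
      s ∈ R ∨ t ∈ R := fun s t m k hst hs ht => by
    by_contra! hc
    obtain ⟨i, hi⟩ := ha' p s (Finset.mem_sdiff.2 ⟨BMR.mem_support.2 ⟨m, hs⟩, hc.1⟩)
    obtain ⟨j, hj⟩ := ha' q t (Finset.mem_sdiff.2 ⟨BMR.mem_support.2 ⟨k, ht⟩, hc.2⟩)
    exact hinc i j (by rwa [hi, hj])
  refine hW p.1 p.2.1.1.1 q.1 q.2.1.1.1 (fun h => hpq (Subtype.ext h)) (BMR.compat_of ?_ ?_)
  · intro t m k hm hk
    have ht : t ∈ R := (hcomp t t m k (.inl le_rfl) hm hk).elim id id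
    rw [hroot t ht, hk] at hm
    exact (Option.some.inj hm).symm
  · intro s t m k hst hs ht
    rcases hcomp s t m k (hst.imp le_of_lt le_of_lt) hs ht with h | h
    · rw [hroot s h] at hs
      rcases hst with hst | hst
      · exact q.1.inj s t hst m k hs ht
      · exact (q.1.inj t s hst k m ht hs).symm
    · rw [← hroot t h] at ht
      rcases hst with hst | hst
      · exact p.1.inj s t hst m k hs ht
      · exact (p.1.inj t s hst k m ht hs).symm

end CCC

/-! ### Names for partial functions from the tree to `ω` -/

section Union

variable {P : Type u} [Preorder P]

theorem fmem_union_left {x y z : Name P} {p : P} (h : fmem z x p) : fmem z (union x y) p := by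
  cases x; cases y
  intro q hq
  obtain ⟨r, hr, i, hi, e⟩ := h q hq
  exact ⟨r, hr, .inl i, hi, e⟩

theorem fmem_union_right {x y z : Name P} {p : P} (h : fmem z y p) : fmem z (union x y) p := by
  cases x; cases y
  intro q hq
  obtain ⟨r, hr, i, hi, e⟩ := h q hq
  exact ⟨r, hr, .inr i, hi, e⟩

end Union

section NodeNames

variable {T : Type u} {P : Type u} [Preorder P] [OrderTop P] {code : T → PSet.{u}}

theorem eq_of_feq_nodePair (hcode : ∀ s t : T, PSet.Equiv (code s) (code t) → s = t)
    {s t : T} {m n : ℕ} {p : P} (h : feq (nodePair code s m) (nodePair code t n) p) :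
    s = t ∧ m = n :=
  ⟨hcode _ _ (equiv_of_feq_check (feq_fst_of_feq_opair h)),
    ofNat_injective (equiv_of_feq_check (feq_snd_of_feq_opair h))⟩

theorem fFunctional_mk (hcode : ∀ s t : T, PSet.Equiv (code s) (code t) → s = t) {ι : Type u}
    {a : ι → Name P} {c : ι → P} {p : P} {t : ι → T} {n : ι → ℕ}
    (ha : ∀ i, a i = nodePair code (t i) (n i))
    (h : ∀ q ≤ p, ∀ i j, q ≤ c i → q ≤ c j → t i = t j → n i = n j) :
    fFunctional (.mk ι a c) p := by
  rintro x y z q hq ⟨h₁, h₂⟩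
  refine feq_of_dense fun r hr => ?_
  obtain ⟨s, hs, i, hi, e₁⟩ := h₁ r hr
  obtain ⟨w, hw, j, hj, e₂⟩ := h₂ s (hs.trans hr)
  rw [ha] at e₁ e₂
  replace e₁ := feq_mono hw e₁
  have hij : t i = t j := hcode _ _ (equiv_of_feq_check
    (feq_trans (feq_symm (feq_fst_of_feq_opair e₁)) (feq_fst_of_feq_opair e₂)))
  have hn := h w (hw.trans (hs.trans (hr.trans hq))) i j (hw.trans hi) hj hij
  refine ⟨w, hw.trans hs, feq_trans (feq_snd_of_feq_opair e₁) ?_⟩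
  rw [hn]
  exact feq_symm (feq_snd_of_feq_opair e₂)

theorem exists_of_fmem_nodePair (hcode : ∀ s t : T, PSet.Equiv (code s) (code t) → s = t)
    {ι : Type u} {a : ι → Name P} {c : ι → P} {p : P} {t : ι → T} {n : ι → ℕ}
    (ha : ∀ i, a i = nodePair code (t i) (n i)) {s : T} {m : ℕ}
    (h : fmem (nodePair code s m) (.mk ι a c) p) : ∃ r ≤ p, ∃ i, r ≤ c i ∧ t i = s ∧ n i = m := by
  obtain ⟨r, hr, i, hi, e⟩ := h p le_rfl
  rw [ha] at e
  obtain ⟨h₁, h₂⟩ := eq_of_feq_nodePair hcode e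
  exact ⟨r, hr, i, hi, h₁.symm, h₂.symm⟩

theorem fmem_nodesTimesOmega {B : Set T} {t : T} (ht : t ∈ B) (n : ℕ) (p : P) :
    fmem (nodePair code t n) (nodesTimesOmega code B) p :=
  fmem_mk (ι := B × ℕ) (a := fun x => nodePair code x.1 x.2) (⟨t, ht⟩, n) le_top

theorem exists_decide_fmem (x : Name P) (S : Finset (T × ℕ)) (p : P) :
    ∃ q ≤ p, ∀ s ∈ S,
      fmem (nodePair code s.1 s.2) x q ∨ fnot (fmem (nodePair code s.1 s.2) x) q := by
  classical
  induction S using Finset.induction_on with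
  | empty => exact ⟨p, le_rfl, by simp⟩
  | insert s S _ ih =>
    obtain ⟨q, hq, h⟩ := ih
    have hmono : ∀ r ≤ q, ∀ s ∈ S,
        fmem (nodePair code s.1 s.2) x r ∨ fnot (fmem (nodePair code s.1 s.2) x) r :=
      fun r hr s hs => (h s hs).imp (fmem_mono hr) fun h' w hw => h' w (hw.trans hr)
    by_cases hs : fmem (nodePair code s.1 s.2) x q
    · refine ⟨q, hq, fun s' hs' => ?_⟩
      rcases Finset.mem_insert.1 hs' with rfl | hs'
      · exact .inl hs
      · exact h s' hs'
    · obtain ⟨r, hr, hr'⟩ := exists_fnot_fmem hs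
      refine ⟨r, hr.trans hq, fun s' hs' => ?_⟩
      rcases Finset.mem_insert.1 hs' with rfl | hs'
      · exact .inr hr'
      · exact hmono r hr s' hs'

/-- The first `j` values of a function in the extension that are in `T × ω` can be decided. -/
theorem exists_decide_values (code : T → PSet.{u}) {f : Name P} {p : P} (hf : fFunctional f p)
    (j : ℕ) :
    ∃ q ≤ p, ∃ S : Finset (T × ℕ), ∀ i < j, ∀ t n, ∀ r ≤ q,
      fmem (opair (check (PSet.ofNat.{u} i)) (nodePair code t n)) f r →
      ∃ s ∈ S, feq (nodePair code t n) (nodePair code s.1 s.2) r := by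
  classical
  induction j with
  | zero => exact ⟨p, le_rfl, ∅, by simp⟩
  | succ j ih =>
    obtain ⟨q, hq, S, hS⟩ := ih
    -- If no extension forces a value of the required form at `j`, the requirement for `j` is
    -- vacuous.
    by_cases h : ∃ r ≤ q, ∃ s : T × ℕ,
        fmem (opair (check (PSet.ofNat.{u} j)) (nodePair code s.1 s.2)) f r
    · obtain ⟨r, hr, s, hs⟩ := h
      refine ⟨r, hr.trans hq, insert s S, fun i hi t n w hw hm => ?_⟩
      rcases Nat.lt_succ_iff_lt_or_eq.1 hi with hi | rfl
      · obtain ⟨s', hs', e⟩ := hS i hi t n w (hw.trans hr) hm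
        exact ⟨s', Finset.mem_insert_of_mem hs', e⟩
      · exact ⟨s, Finset.mem_insert_self _ _,
          hf _ _ _ w (hw.trans (hr.trans hq)) ⟨hm, fmem_mono hw hs⟩⟩
    · refine ⟨q, hq, S, fun i hi t n w hw hm => ?_⟩
      rcases Nat.lt_succ_iff_lt_or_eq.1 hi with hi | rfl
      · exact hS i hi t n w hw hm
      · exact (h ⟨w, hw, (t, n), hm⟩).elim

/-- A finite subset of `T × ω` in the extension is in the ground model. -/
theorem exists_decide_finite {x : Name P} {B : Set T} {p : P} (hfin : fFinite x p)
    (hsub : fsub x (nodesTimesOmega code B) p) :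
    ∃ q ≤ p, ∃ S : Finset (T × ℕ), (∀ s ∈ S, fmem (nodePair code s.1 s.2) x q) ∧
      ∀ z, ∀ r ≤ q, fmem z x r → ∃ w ≤ r, ∃ s ∈ S, feq z (nodePair code s.1 s.2) w := by
  classical
  obtain ⟨p₁, hp₁, kn, hkn, henum⟩ := hfin p le_rfl
  obtain ⟨p₂, hp₂, k, hk⟩ := exists_of_fmem_check_omega hkn
  obtain ⟨p₃, hp₃, f, hf, hval⟩ := henum p₂ hp₂
  obtain ⟨p₄, hp₄, S, hS⟩ := exists_decide_values code hf k
  -- `S` covers the values of `f` below `k` but may contain pairs outside `x`; once membership is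
  -- decided, these can be filtered out.
  obtain ⟨q, hq, hdec⟩ := exists_decide_fmem (code := code) x S p₄
  refine ⟨q, hq.trans (hp₄.trans (hp₃.trans (hp₂.trans hp₁))),
    S.filter fun s => fmem (nodePair code s.1 s.2) x q,
    fun s hs => (Finset.mem_filter.1 hs).2, fun z r hr hz => ?_⟩
  have hr₃ : r ≤ p₃ := hr.trans (hq.trans hp₄)
  obtain ⟨r₁, hr₁, m, hm, hmz⟩ := hval z r hr₃ hz r le_rfl
  obtain ⟨r₂, hr₂, i, hi, e⟩ := exists_of_fmem_check_ofNat
    (fmem_congr_right (feq_mono (hr₁.trans (hr₃.trans hp₃)) hk) hm)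
  have hr₂r : r₂ ≤ r := hr₂.trans hr₁
  obtain ⟨r₃, hr₃', ⟨t, n⟩, -, e'⟩ := hsub z r₂
    (hr₂r.trans (hr₃.trans (hp₃.trans (hp₂.trans hp₁)))) (fmem_mono hr₂r hz) r₂ le_rfl
  have hr₃r := hr₃'.trans hr₂r
  obtain ⟨s, hs, e''⟩ := hS i hi t n r₃ (hr₃r.trans (hr.trans hq)) (fmem_congr_left
    (opair_congr (feq_mono hr₃' e) e') (fmem_mono (hr₃'.trans hr₂) hmz))
  have hzs := feq_trans e' e''
  have hsx := fmem_congr_left hzs (fmem_mono hr₃r hz)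
  refine ⟨r₃, hr₃r, s, Finset.mem_filter.2 ⟨hs, (hdec s hs).resolve_right fun h => ?_⟩, hzs⟩
  exact h r₃ (hr₃r.trans hr) hsx

section Restrict

variable [PartialOrder T]

theorem fmem_checkRestrict {B : Set T} {r : BMR T} {t : T} {n : ℕ} (ht : t ∈ B)
    (h : r.fn.val t = some n) (p : P) : fmem (nodePair code t n) (checkRestrict code r B) p :=
  fmem_mk (ι := {x : T × ℕ // x.1 ∈ B ∧ r.fn.val x.1 = some x.2})
    (a := fun x => nodePair code x.1.1 x.1.2) ⟨(t, n), ht, h⟩ le_top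

theorem fFinite_checkRestrict (r : BMR T) (B : Set T) (p : P) :
    fFinite (checkRestrict code r B : Name P) p := by
  let I := {x : T × ℕ // x.1 ∈ B ∧ r.fn.val x.1 = some x.2}
  have : Finite I := by
    refine Finite.of_injective
      (fun x : I => (⟨x.1.1, BMR.mem_support.2 ⟨_, x.2.2⟩⟩ : r.support)) fun x y h => ?_
    have h' : x.1.1 = y.1.1 := congrArg Subtype.val h
    have hx := x.2.2
    rw [h', y.2.2] at hx
    exact Subtype.ext (Prod.ext h' (Option.some.inj hx).symm)
  obtain ⟨k, ⟨g⟩⟩ := Finite.exists_equiv_fin I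
  let a : I → Name P := fun x => opair (check (PSet.ofNat.{u} (g x))) (nodePair code x.1.1 x.1.2)
  intro q _
  refine ⟨q, le_rfl, _, fmem_check_omega k q, fun q' _ => ⟨q', le_rfl, .mk I a fun _ => ⊤, ?_, ?_⟩⟩
  · rintro x y z q hq ⟨h₁, h₂⟩
    refine feq_of_dense fun r hr => ?_
    obtain ⟨s, hs, i, -, e₁⟩ := h₁ r hr
    obtain ⟨w, hw, j, -, e₂⟩ := h₂ s (hs.trans hr)
    replace e₁ := feq_mono hw e₁
    have hij : i = j := g.injective (Fin.ext (ofNat_injective (equiv_of_feq_check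
      (feq_trans (feq_symm (feq_fst_of_feq_opair e₁)) (feq_fst_of_feq_opair e₂)))))
    subst hij
    exact ⟨w, hw.trans hs, feq_trans (feq_snd_of_feq_opair e₁)
      (feq_symm (feq_snd_of_feq_opair e₂))⟩
  · intro y s hs hy s' hs'
    obtain ⟨w, hw, i, -, e⟩ := hy s' hs'
    refine ⟨w, hw, check (PSet.ofNat.{u} (g i)),
      fmem_check (mem_ofNat_iff.2 ⟨_, (g i).2, PSet.Equiv.refl _⟩) w, ?_⟩
    exact fmem_congr_left (opair_congr (feq_refl _ _) (feq_symm e))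
      (fmem_mk (a := a) (c := fun _ => ⊤) i le_top)

end Restrict

end NodeNames

/-! ### The forcing `Q_A` and the projection to it -/

section QA

variable {T : Type u} [PartialOrder T]

theorem BMR.countable_of_support_subset {A : Set T} (hA : A.Countable) :
    {s : BMR T | s.fn.dom ⊆ A}.Countable := by
  let graph : BMR T → Set (T × ℕ) := fun s => {x | s.fn.val x.1 = some x.2}
  have hmaps : Set.MapsTo graph {s : BMR T | s.fn.dom ⊆ A}
      {F | F.Finite ∧ F ⊆ A ×ˢ (Set.univ : Set ℕ)} := fun s hs => by
    refine ⟨?_, fun x hx => ⟨hs ?_, trivial⟩⟩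
    · refine Set.Finite.of_finite_image (f := Prod.fst) (s.fn.finite.subset ?_) ?_
      · rintro _ ⟨x, hx, rfl⟩
        simp [show s.fn.val x.1 = some x.2 from hx]
      · intro x hx y hy h
        have h' : s.fn.val x.1 = some x.2 := hx
        rw [h, show s.fn.val y.1 = some y.2 from hy] at h'
        exact Prod.ext h (Option.some.inj h').symm
    · simp [FinPart.dom, show s.fn.val x.1 = some x.2 from hx]
  refine hmaps.countable_of_injOn (fun s _ s' _ h => ?_)
    (Set.countable_ofPred_finite_subset (hA.prod Set.countable_univ))
  refine BMR.ext (FinPart.ext (funext fun t => Option.ext fun n => ?_))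
  exact Set.ext_iff.1 h (t, n)

/-- Conditions with the same stem have a common extension. -/
theorem QA.sigmaCentered {A : Set T} (hA : A.Countable) : SigmaCentered (QA A) := by
  classical
  obtain ⟨s, hs⟩ := (BMR.countable_of_support_subset hA).exists_eq_range
    ⟨⊤, fun t h => (h rfl).elim⟩
  refine ⟨fun n => {q | q.stem = s n}, fun n F hF => ?_, ?_⟩
  · have hsn : (s n).fn.dom ⊆ A := (hs ▸ Set.mem_range_self n : s n ∈ {s : BMR T | s.fn.dom ⊆ A})
    -- Unite the promises. `keep` survives because it compares each promised value with the common
    -- stem only.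
    let val : T → Option (Finset ℕ) := fun t =>
      if ∃ q ∈ F, q.promise.val t ≠ none then
        some (F.biUnion fun q => (q.promise.val t).getD ∅) else none
    have hval : ∀ t, val t ≠ none → ∃ q ∈ F, q.promise.val t ≠ none := fun t ht => by
      by_contra hc
      exact ht (if_neg hc)
    refine ⟨⟨s n, ⟨val, ?_⟩, hsn, fun t ht => ?_, ?_⟩, fun q hq => ⟨?_, ?_⟩⟩
    · refine (F.finite_toSet.biUnion fun q _ => q.promise.finite).subset fun t ht => ?_
      obtain ⟨q, hq, h⟩ := hval t ht
      exact Set.mem_biUnion (Finset.mem_coe.2 hq) h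
    · obtain ⟨q, -, h⟩ := hval t ht
      exact q.promise_dom h
    · intro t t' G m hm hG htt'
      have hG' : val t' = some G := hG
      have hne := hval t' (by simp [hG'])
      simp only [val, if_pos hne, Option.some.injEq] at hG'
      rw [← hG', Finset.mem_biUnion] at hm
      obtain ⟨q, hq, hmq⟩ := hm
      cases hqt : q.promise.val t' with
      | none => simp [hqt] at hmq
      | some G' =>
        rw [hqt] at hmq
        have := q.keep t t' G' m hmq hqt htt'
        rwa [show q.stem = s n from hF hq] at this
    · exact le_of_eq (show q.stem = s n from hF hq).symm
    · intro t G hG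
      refine ⟨_, if_pos ⟨q, hq, by simp [hG]⟩, fun m hm => Finset.mem_biUnion.2 ⟨q, hq, ?_⟩⟩
      simpa [hG] using hm
  · refine Set.eq_univ_of_forall fun q => ?_
    obtain ⟨n, hn⟩ : q.stem ∈ Set.range s := hs ▸ q.stem_dom
    exact Set.mem_iUnion.2 ⟨n, hn.symm⟩

open Classical in
/-- The restriction of a condition to `A`. -/
noncomputable def BMR.restrict (p : BMR T) (A : Set T) : BMR T where
  fn := ⟨fun t => if t ∈ A then p.fn.val t else none, p.fn.finite.subset fun t ht => by
    simp only [Set.mem_ofPred_eq] at ht ⊢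
    split_ifs at ht
    · exact ht
    · exact (ht rfl).elim⟩
  inj s t hst m n hm hn := by
    simp only at hm hn
    split_ifs at hm hn
    exact p.inj s t hst m n hm hn

theorem BMR.restrict_val {p : BMR T} {A : Set T} {t : T} {n : ℕ} :
    (p.restrict A).fn.val t = some n ↔ t ∈ A ∧ p.fn.val t = some n := by
  simp [BMR.restrict]

open Classical in
/-- The values of a condition on the cone above a node. -/
noncomputable def BMR.valuesAbove (p : BMR T) (t : T) : Finset ℕ :=
  (p.support.filter (t ≤ ·)).image fun s => (p.fn.val s).getD 0

theorem BMR.mem_valuesAbove {p : BMR T} {t : T} {n : ℕ} :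
    n ∈ p.valuesAbove t ↔ ∃ s, t ≤ s ∧ p.fn.val s = some n := by
  simp only [valuesAbove, Finset.mem_image, Finset.mem_filter, BMR.mem_support]
  constructor
  · rintro ⟨s, ⟨⟨m, hm⟩, hs⟩, h⟩
    exact ⟨s, hs, by simp_all⟩
  · rintro ⟨s, hs, h⟩
    exact ⟨s, ⟨⟨n, h⟩, hs⟩, by simp [h]⟩

variable [IsTreeOrder T]

open Classical in
/-- The projection of a condition to `Q_A`: the values outside of `A` are promised to be avoided
below them. -/
noncomputable def BMR.toQA (p : BMR T) (A : Set T) : QA A where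
  stem := p.restrict A
  -- Non-emptiness keeps the domain finite when the border is infinite, and makes `⊤` project to
  -- `⊤`.
  promise := ⟨fun t => if t ∈ border A ∧ (p.valuesAbove t).Nonempty then some (p.valuesAbove t)
    else none, by
      refine Set.Finite.subset (p.support.finite_toSet.biUnion
        (t := fun s => {t | t ∈ border A ∧ t ≤ s}) fun s _ => ?_) fun t ht => ?_
      · exact Set.Subsingleton.finite fun a ha b hb => border_eq_of_le ha.1 hb.1 ha.2 hb.2
      · simp only [ne_eq, ite_eq_right_iff, reduceCtorEq, imp_false, not_not,
          Set.mem_ofPred_eq] at ht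
        obtain ⟨n, hn⟩ := ht.2
        obtain ⟨s, hs, h⟩ := BMR.mem_valuesAbove.1 hn
        exact Set.mem_biUnion (Finset.mem_coe.2 (BMR.mem_support.2 ⟨n, h⟩)) ⟨ht.1, hs⟩⟩
  stem_dom t ht := by
    obtain ⟨n, hn⟩ := Option.ne_none_iff_exists'.1 ht
    exact (BMR.restrict_val.1 hn).1
  promise_dom t ht := by
    by_contra h
    exact ht (if_neg fun h' => h h'.1)
  keep t t' F n hn hF htt' hst := by
    simp only [Option.ite_none_right_eq_some, Option.some.injEq] at hF
    obtain ⟨⟨hb, -⟩, rfl⟩ := hF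
    obtain ⟨s, hs, h⟩ := BMR.mem_valuesAbove.1 hn
    obtain ⟨htA, htn⟩ := BMR.restrict_val.1 hst
    refine p.inj t s ((htt'.trans hs).lt_of_ne ?_) n n htn h rfl
    rintro rfl
    exact hb.1 (le_antisymm htt' hs ▸ htA)

theorem BMR.toQA_promise {p : BMR T} {A : Set T} {t : T} {F : Finset ℕ} :
    (p.toQA A).promise.val t = some F ↔
      (t ∈ border A ∧ (p.valuesAbove t).Nonempty) ∧ p.valuesAbove t = F := by
  simp [BMR.toQA]

theorem BMR.toQA_mono {p q : BMR T} (A : Set T) (h : p ≤ q) : p.toQA A ≤ q.toQA A := by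
  refine ⟨fun t n ht => ?_, fun t F hF => ?_⟩
  · obtain ⟨htA, ht⟩ := BMR.restrict_val.1 ht
    exact BMR.restrict_val.2 ⟨htA, h t n ht⟩
  · obtain ⟨⟨hb, hne⟩, rfl⟩ := BMR.toQA_promise.1 hF
    have hsub : q.valuesAbove t ⊆ p.valuesAbove t := fun n hn => by
      obtain ⟨s, hs, hn⟩ := BMR.mem_valuesAbove.1 hn
      exact BMR.mem_valuesAbove.2 ⟨s, hs, h s n hn⟩
    exact ⟨_, BMR.toQA_promise.2 ⟨⟨hb, hne.mono hsub⟩, rfl⟩, hsub⟩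

theorem BMR.toQA_top (A : Set T) : (⊤ : BMR T).toQA A = ⊤ := by
  have hval : ∀ t : T, (⊤ : BMR T).fn.val t = none := fun _ => rfl
  refine QA.ext (BMR.ext (FinPart.ext (funext fun t => ?_))) (FinPart.ext (funext fun t => ?_))
  · exact Option.eq_none_iff_forall_ne_some.2 fun n hn => by
      simpa [hval] using (BMR.restrict_val.1 hn).2
  · exact Option.eq_none_iff_forall_ne_some.2 fun F hF => by
      obtain ⟨n, hn⟩ := (BMR.toQA_promise.1 hF).1.2
      obtain ⟨s, -, hs⟩ := BMR.mem_valuesAbove.1 hn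
      simp [hval] at hs

/-- Realizing one promised value on the cone above a border node. -/
theorem IsGenAronszajn.exists_le_realize (hT : IsGenAronszajn T) {A : Set T}
    (hA : IsLowerSet A) (p : BMR T) {b : T} {n : ℕ} (hb : b ∈ border A)
    (hn : ∀ t ∈ A, t ≤ b → p.fn.val t ≠ some n) :
    ∃ q ≤ p, (∀ t ∈ A, q.fn.val t = p.fn.val t) ∧ ∃ s, b ≤ s ∧ q.fn.val s = some n := by
  classical
  by_cases h : ∃ s, b ≤ s ∧ p.fn.val s = some n
  · exact ⟨p, le_rfl, fun _ _ => rfl, h⟩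
  push Not at h
  -- Give the value `n` to a fresh node `s` of the cone. A node below `s` is comparable with `b`, so
  -- it is either in the cone, where `n` is unused by `h`, or in `A` below `b`, where `hn` applies.
  obtain ⟨s, hbs, hsp⟩ := ((hT.infinite_Ici b).sdiff p.support.finite_toSet).nonempty
  have hsnone : p.fn.val s = none := by
    by_contra hc
    exact hsp (Finset.mem_coe.2 (BMR.mem_support.2 (Option.ne_none_iff_exists'.1 hc)))
  have hlt : ∀ t < s, p.fn.val t ≠ some n := fun t ht => by
    rcases le_total_of_le ht.le hbs with h' | h'
    · rcases h'.eq_or_lt with rfl | h'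
      · exact h t le_rfl
      · exact hn t (hb.2 h') h'.le
    · exact h t h'
  refine ⟨⟨⟨Function.update p.fn.val s (some n), ?_⟩, ?_⟩, ?_, ?_, s, hbs, by simp⟩
  · refine (p.fn.finite.insert s).subset fun t ht => ?_
    by_cases hts : t = s
    · exact .inl hts
    · exact .inr (by simpa [hts] using ht)
  · intro u v huv m k hm hk
    by_cases hu : u = s
    · subst hu
      have hv : v ≠ u := huv.ne'
      simp only [Function.update_self, Option.some.injEq] at hm
      simp only [Function.update_of_ne hv] at hk
      rintro rfl
      exact h v (le_trans hbs huv.le) (hm ▸ hk)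
    · simp only [Function.update_of_ne hu] at hm
      by_cases hv : v = s
      · subst hv
        simp only [Function.update_self, Option.some.injEq] at hk
        rintro rfl
        exact hlt u huv (hk ▸ hm)
      · simp only [Function.update_of_ne hv] at hk
        exact p.inj u v huv m k hm hk
  · intro t m ht
    have hts : t ≠ s := by
      rintro rfl
      simp [hsnone] at ht
    simpa [hts] using ht
  · intro t htA
    have hts : t ≠ s := by
      rintro rfl
      exact hb.1 (hA hbs htA)
    simp [hts]

end QA

/-! ### The dense embedding into the iteration -/

section Embedding

variable {T : Type u} [PartialOrder T] {code : T → PSet.{u}}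

theorem fmem_hName {A : Set T} {q : QA A} {t : T} {n : ℕ} (h : q.stem.fn.val t = some n) :
    fmem (nodePair code t n) (hName code A) q :=
  fmem_mk (ι := {x : (T × ℕ) × QA A // x.2.stem.fn.val x.1.1 = some x.1.2})
    (a := fun x => nodePair code x.1.1.1 x.1.1.2) (c := fun x => x.1.2) ⟨((t, n), q), h⟩ le_rfl

theorem fR_mono {A : Set T} {x : Name (QA A)} {p q : QA A} (hq : q ≤ p) (h : fR code A x p) :
    fR code A x q :=
  ⟨⟨fun r hr => h.1.1 r (hr.trans hq), fsub_mono hq h.1.2.1,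
    fun x y z r hr => h.1.2.2 x y z r (hr.trans hq)⟩,
    ⟨fsub_mono hq h.2.1.1, fun x y z r hr => h.2.1.2 x y z r (hr.trans hq)⟩,
    fun x n r hr => h.2.2 x n r (hr.trans hq)⟩

variable [IsTreeOrder T]

/-- Realizing finitely many promised values. -/
theorem IsGenAronszajn.exists_le_realize_all (hT : IsGenAronszajn T) {A : Set T}
    (hA : IsLowerSet A) (p : BMR T) (S : Finset (T × ℕ)) (hS : ∀ x ∈ S, x.1 ∈ border A ∧
      ∀ t ∈ A, t ≤ x.1 → p.fn.val t ≠ some x.2) :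
    ∃ q ≤ p, (∀ t ∈ A, q.fn.val t = p.fn.val t) ∧
      ∀ x ∈ S, ∃ s, x.1 ≤ s ∧ q.fn.val s = some x.2 := by
  classical
  induction S using Finset.induction_on with
  | empty => exact ⟨p, le_rfl, fun _ _ => rfl, by simp⟩
  | insert x S _ ih =>
    obtain ⟨q, hq, hqA, hqS⟩ := ih fun y hy => hS y (Finset.mem_insert_of_mem hy)
    obtain ⟨hb, hx⟩ := hS x (Finset.mem_insert_self _ _)
    obtain ⟨r, hr, hrA, hrx⟩ := hT.exists_le_realize hA q hb (n := x.2)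
      fun t ht htx => hqA t ht ▸ hx t ht htx
    refine ⟨r, hr.trans hq, fun t ht => (hrA t ht).trans (hqA t ht), fun y hy => ?_⟩
    rcases Finset.mem_insert.1 hy with rfl | hy
    · exact hrx
    · obtain ⟨s, hs, h⟩ := hqS y hy
      exact ⟨s, hs, hr s _ h⟩

/-- Every condition of `Q_A` is above the projection of a condition with the same stem. -/
theorem IsGenAronszajn.exists_toQA_le (hT : IsGenAronszajn T) {A : Set T} (hA : IsLowerSet A)
    (q : QA A) (p : BMR T) (hp : ∀ t ∈ A, p.fn.val t = q.stem.fn.val t) :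
    ∃ r ≤ p, r.toQA A ≤ q := by
  classical
  -- A spare value, unused by the stem, is realized along with each promise: `q` may promise the
  -- empty set at a node, while `toQA` records a promise only on cones where some value occurs.
  obtain ⟨k, hk⟩ : ∃ k : ℕ, ∀ t, q.stem.fn.val t ≠ some k := by
    obtain ⟨k, hk⟩ := Infinite.exists_notMem_finset
      (q.stem.support.image fun t => (q.stem.fn.val t).getD 0)
    refine ⟨k, fun t ht => hk (Finset.mem_image.2 ⟨t, BMR.mem_support.2 ⟨k, ht⟩, by simp [ht]⟩)⟩
  let D : Finset T := q.promise.finite.toFinset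
  have hD : ∀ t F, q.promise.val t = some F → t ∈ D := fun t F h => by simp [D, h]
  let S : Finset (T × ℕ) := D.biUnion fun t =>
    (insert k ((q.promise.val t).getD ∅)).image fun n => (t, n)
  have hS : ∀ t F n, q.promise.val t = some F → n = k ∨ n ∈ F → (t, n) ∈ S := fun t F n h hn => by
    simp only [S, Finset.mem_biUnion, Finset.mem_image]
    exact ⟨t, hD t F h, n, by simpa [h] using hn, rfl⟩
  obtain ⟨r, hr, hrA, hrS⟩ := hT.exists_le_realize_all hA p S fun x hx => by
    simp only [S, Finset.mem_biUnion, Finset.mem_image] at hx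
    obtain ⟨t, ht, n, hn, rfl⟩ := hx
    have ht' : q.promise.val t ≠ none := by simpa [D] using ht
    refine ⟨q.promise_dom ht', fun s hs hst => ?_⟩
    rw [hp s hs]
    obtain ⟨F, hF⟩ := Option.ne_none_iff_exists'.1 ht'
    rcases Finset.mem_insert.1 hn with rfl | hn
    · exact hk s
    · exact q.keep s t F n (by simpa [hF] using hn) hF hst
  refine ⟨r, hr, fun t n ht => ?_, fun t F hF => ?_⟩
  · have htA : t ∈ A := q.stem_dom (by simp [FinPart.dom, ht])
    exact BMR.restrict_val.2 ⟨htA, by rw [hrA t htA, hp t htA, ht]⟩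
  · refine ⟨_, BMR.toQA_promise.2 ⟨⟨q.promise_dom (by simp [FinPart.dom, hF]), k, ?_⟩, rfl⟩,
      fun n hn => ?_⟩
    · exact BMR.mem_valuesAbove.2 (hrS _ (hS t F k hF (.inl rfl)))
    · exact BMR.mem_valuesAbove.2 (hrS _ (hS t F n hF (.inr hn)))

/-- The critical conflict is between `s ∈ A` and `t ∉ A` above it with the same value `n`. The
border node below `t` is also above `s` and promises to avoid `n`, which `keep` enforces for every
stronger stem. -/
theorem fR_toQA (hcode : ∀ s t : T, PSet.Equiv (code s) (code t) → s = t) {A : Set T}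
    (hA : IsLowerSet A) (p : BMR T) : fR code A (checkRestrict code p Aᶜ) (p.toQA A) := by
  let I := {x : T × ℕ // x.1 ∈ Aᶜ ∧ p.fn.val x.1 = some x.2}
  let J := {x : (T × ℕ) × QA A // x.2.stem.fn.val x.1.1 = some x.1.2}
  let c : I ⊕ J → QA A := Sum.elim (fun _ => ⊤) fun x => x.1.2
  let v : I ⊕ J → T × ℕ := Sum.elim (fun x => x.1) fun x => x.1.1
  have hv : ∀ i, (Sum.elim (fun x : I => (nodePair code x.1.1 x.1.2 : Name (QA A)))
      (fun x : J => nodePair code x.1.1.1 x.1.1.2)) i = nodePair code (v i).1 (v i).2 := by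
    rintro (i | j) <;> rfl
  have hc : ∀ q i, q ≤ c i → ((v i).1 ∉ A ∧ p.fn.val (v i).1 = some (v i).2) ∨
      ((v i).1 ∈ A ∧ q.stem.fn.val (v i).1 = some (v i).2) := by
    rintro q (i | j) hi
    · exact .inl i.2
    · exact .inr ⟨j.1.2.stem_dom (by simp [v, FinPart.dom, j.2]), hi.1 _ _ j.2⟩
  refine ⟨⟨fFinite_checkRestrict p Aᶜ _, fsub_mk fun i q _ _ => fmem_nodesTimesOmega i.2.1 _ q,
    fFunctional_mk (t := fun i : I => i.1.1) (n := fun i => i.1.2) hcode (fun _ => rfl) ?_⟩,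
    ⟨fsub_mk fun i q _ _ => ?_, fFunctional_mk hcode hv ?_⟩, ?_⟩
  · intro q _ i j _ _ hij
    have := i.2.2
    rw [hij, j.2.2] at this
    exact (Option.some.inj this).symm
  · rw [hv]
    exact fmem_nodesTimesOmega (Set.mem_univ _) _ q
  · intro q _ i j hi hj hij
    rcases hc q i hi with ⟨h₁, h₂⟩ | ⟨h₁, h₂⟩ <;> rcases hc q j hj with ⟨h₃, h₄⟩ | ⟨h₃, h₄⟩
    · rw [hij, h₄] at h₂
      exact (Option.some.inj h₂).symm
    · exact (h₁ (hij ▸ h₃)).elim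
    · exact (h₃ (hij ▸ h₁)).elim
    · rw [hij, h₄] at h₂
      exact (Option.some.inj h₂).symm
  · rintro ⟨⟨s, t⟩, hst⟩ n q hq ⟨hs, ht⟩
    obtain ⟨q₁, hq₁, i, hi, hi₁, hi₂⟩ := exists_of_fmem_nodePair hcode hv hs
    obtain ⟨q₂, hq₂, j, hj, hj₁, hj₂⟩ := exists_of_fmem_nodePair hcode hv (fmem_mono hq₁ ht)
    have hi' := hc q₂ i (hq₂.trans hi)
    have hj' := hc q₂ j hj
    rw [hi₁, hi₂] at hi'
    rw [hj₁, hj₂] at hj'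
    simp only at hi' hj'
    have hst' : s < t := hst
    rcases hi' with ⟨h₁, h₂⟩ | ⟨h₁, h₂⟩ <;> rcases hj' with ⟨h₃, h₄⟩ | ⟨h₃, h₄⟩
    · exact p.inj s t hst n n h₂ h₄ rfl
    · exact h₁ (hA hst'.le h₃)
    · obtain ⟨b, hb, hbt⟩ := exists_border_le h₃
      have hn : n ∈ p.valuesAbove b := BMR.mem_valuesAbove.2 ⟨t, hbt, h₄⟩
      obtain ⟨F, hF, hsub⟩ := (hq₂.trans (hq₁.trans hq)).2 b _
        (BMR.toQA_promise.2 ⟨⟨hb, n, hn⟩, rfl⟩)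
      exact q₂.keep s b F n (hsub hn) hF (le_border hA h₁ hb hbt hst'.le) h₂
    · exact q₂.stem.inj s t hst n n h₂ h₄ rfl

/-- The embedding of `P(T)` into the iteration. -/
noncomputable def embed (hcode : ∀ s t : T, PSet.Equiv (code s) (code t) → s = t) {A : Set T}
    (hA : IsLowerSet A) (p : BMR T) : Iter (QA A) (fR code A) :=
  ⟨p.toQA A, checkRestrict code p Aᶜ, fR_toQA hcode hA p⟩

/-- The stem recovers a condition on `A`, and the forced inclusion of check names recovers it off
`A`. -/
theorem embed_le_iff (hcode : ∀ s t : T, PSet.Equiv (code s) (code t) → s = t) {A : Set T}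
    (hA : IsLowerSet A) (p q : BMR T) : embed hcode hA p ≤ embed hcode hA q ↔ p ≤ q := by
  refine ⟨fun h t n ht => ?_, fun h => ⟨BMR.toQA_mono A h, fsub_mk fun i r _ _ => ?_⟩⟩
  · by_cases htA : t ∈ A
    · exact (BMR.restrict_val.1 (h.1.1 t n (BMR.restrict_val.2 ⟨htA, ht⟩))).2
    · have hm := h.2 _ _ le_rfl (fmem_checkRestrict (code := code) (B := Aᶜ) htA ht (p.toQA A))
      obtain ⟨r, -, i, -, h₁, h₂⟩ := exists_of_fmem_nodePair hcode
        (t := fun i : {x : T × ℕ // x.1 ∈ Aᶜ ∧ p.fn.val x.1 = some x.2} => i.1.1)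
        (n := fun i => i.1.2) (fun _ => rfl) hm
      have := i.2.2
      rwa [h₁, h₂] at this
  · exact fmem_checkRestrict i.2.1 (h _ _ i.2.2) r

/-- Once `x` is decided to be the finite set `S`, the stem and `S` form a condition, since `q`
forces the union of `x` and `ḣ` to be injective on chains. Realizing the promises of `q` only
extends it. -/
theorem embed_dense (hT : IsGenAronszajn T)
    (hcode : ∀ s t : T, PSet.Equiv (code s) (code t) → s = t) {A : Set T} (hA : IsLowerSet A)
    (a : Iter (QA A) (fR code A)) : ∃ p, embed hcode hA p ≤ a := by
  classical
  obtain ⟨q₀, x, ⟨hfin, hsub, hfun⟩, -, hinj⟩ := a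
  obtain ⟨q, hq, S, hSx, hxS⟩ := exists_decide_finite hfin hsub
  have hSA : ∀ s ∈ S, s.1 ∉ A := fun s hs => by
    obtain ⟨r, -, i, -, h, -⟩ := exists_of_fmem_nodePair hcode
      (t := fun i : ↥Aᶜ × ℕ => i.1.1) (n := fun i => i.2) (fun _ => rfl) (hsub _ q hq (hSx s hs))
    exact h ▸ i.1.2
  have hSfun : ∀ t m n, (t, m) ∈ S → (t, n) ∈ S → m = n := fun t m n hm hn =>
    ofNat_injective (equiv_of_feq_check (hfun _ _ _ q hq ⟨hSx _ hm, hSx _ hn⟩))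
  have hSinj : ∀ s t n, s < t → (t, n) ∈ S → (s, n) ∈ S ∨ q.stem.fn.val s = some n → False :=
    fun s t n hst ht hs => hinj ⟨(s, t), hst⟩ n q hq
      ⟨hs.elim (fun hs => fmem_union_left (hSx _ hs)) fun hs => fmem_union_right (fmem_hName hs),
        fmem_union_left (hSx _ ht)⟩
  let val : T → Option ℕ := fun t =>
    if t ∈ A then q.stem.fn.val t else if h : ∃ n, (t, n) ∈ S then some h.choose else none
  have hval : ∀ t n, val t = some n → (t ∈ A ∧ q.stem.fn.val t = some n) ∨ (t, n) ∈ S := by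
    intro t n h
    simp only [val] at h
    split_ifs at h with h₁ h₂
    · exact .inl ⟨h₁, h⟩
    · exact .inr (Option.some.inj h ▸ h₂.choose_spec)
  have hvalS : ∀ t n, (t, n) ∈ S → val t = some n := fun t n h => by
    have h₂ : ∃ n, (t, n) ∈ S := ⟨n, h⟩
    simp only [val, if_neg (hSA _ h), dif_pos h₂, Option.some.injEq]
    exact hSfun t _ _ h₂.choose_spec h
  let p : BMR T := ⟨⟨val, by
    refine (q.stem.fn.finite.union (S.image Prod.fst).finite_toSet).subset fun t ht => ?_
    obtain ⟨n, hn⟩ := Option.ne_none_iff_exists'.1 ht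
    rcases hval t n hn with h | h
    · exact .inl (by simp [h.2])
    · exact .inr (Finset.mem_coe.2 (Finset.mem_image_of_mem _ h))⟩, by
    rintro s t hst m n hs ht rfl
    rcases hval t m ht with h | h
    · rcases hval s m hs with h' | h'
      · exact q.stem.inj s t hst m m h'.2 h.2 rfl
      · exact hSA _ h' (hA hst.le h.1)
    · exact hSinj s t m hst h ((hval s m hs).symm.imp id And.right)⟩
  obtain ⟨r, hr, hrq⟩ := hT.exists_toQA_le hA q p fun t ht => if_pos ht
  refine ⟨r, hrq.trans hq, fun z w hw hz => fmem_of_dense fun w' hw' => ?_⟩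
  obtain ⟨w₁, hw₁, s, hs, e⟩ := hxS z w' (hw'.trans (hw.trans hrq)) (fmem_mono hw' hz)
  exact ⟨w₁, hw₁, fmem_congr_left (feq_symm e)
    (fmem_checkRestrict (hSA s hs) (hr _ _ (hvalS _ _ hs)) w₁)⟩

theorem isDenseEmb_embed (hT : IsGenAronszajn T)
    (hcode : ∀ s t : T, PSet.Equiv (code s) (code t) → s = t) {A : Set T} (hA : IsLowerSet A) :
    IsDenseEmb (embed hcode hA) where
  le_iff := embed_le_iff hcode hA
  dense := embed_dense hT hcode hA
  incompat p q h := fun ⟨a, hp, hq⟩ => by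
    obtain ⟨r, hr⟩ := embed_dense hT hcode hA a
    exact h ⟨r, (embed_le_iff hcode hA r p).1 (hr.trans hp),
      (embed_le_iff hcode hA r q).1 (hr.trans hq)⟩

/-- For `q` below the projection of `p`, the pair of `q` and `p ↾ (T \ A)` is in the iteration and
below the image of `p`; density gives a condition whose image is below this pair. -/
theorem isProjection_toQA (hT : IsGenAronszajn T) {A : Set T} (hA : IsLowerSet A)
    (hcode : ∀ s t : T, PSet.Equiv (code s) (code t) → s = t) :
    IsProjection fun p : BMR T => p.toQA A where
  mono _ _ h := BMR.toQA_mono A h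
  top := BMR.toQA_top A
  lift p q hq := by
    obtain ⟨r, hr⟩ := embed_dense hT hcode hA
      ⟨q, checkRestrict code p Aᶜ, fR_mono hq (fR_toQA hcode hA p)⟩
    exact ⟨r, (embed_le_iff hcode hA r p).1 (hr.trans ⟨hq, fun _ _ _ h => h⟩), hr.1⟩

theorem feq_pull_hName (code : T → PSet.{u}) (A : Set T) (p : BMR T) :
    feq (pull (fun p : BMR T => p.toQA A) (hName code A)) (gName code A) p := by
  have key : ∀ t n q, feq (pull (fun p : BMR T => p.toQA A) (nodePair code t n))
      (nodePair code t n) q := fun t n q =>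
    feq_pull_opair _ (feq_pull_check _ _ q) (feq_pull_check _ _ q)
  refine ⟨?_, ?_⟩
  · rintro ⟨⟨⟨⟨t, n⟩, a⟩, ha⟩, ⟨r, hr⟩⟩ q - hqr
    have hqr' : q ≤ r := hqr
    obtain ⟨htA, ht⟩ := BMR.restrict_val.1 (((BMR.toQA_mono A hqr').trans hr).1 t n ha)
    exact ⟨q, le_rfl, ⟨((t, n), q), htA, ht⟩, le_rfl, key t n q⟩
  · rintro ⟨⟨⟨t, n⟩, r⟩, htA, ht⟩ q - hqr
    -- The entry of `ḣ` to use is weighted by the projection of `q`, and its pulled-back copy by `q`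
    -- itself.
    exact ⟨q, le_rfl, ⟨⟨((t, n), q.toQA A), BMR.restrict_val.2 ⟨htA, hqr t n ht⟩⟩, q, le_rfl⟩,
      le_rfl, key t n q⟩

end Embedding

/-! ### Countable sets of ordinals in the extension -/

section CountableSets

/-- A maximal antichain among the conditions in `D`. -/
theorem exists_maximal_antichain {P : Type*} [Preorder P] (D : Set P) :
    ∃ W ⊆ D, (∀ p ∈ W, ∀ q ∈ W, p ≠ q → ¬ Compat p q) ∧ ∀ p ∈ D, ∃ w ∈ W, Compat p w := by
  -- Antichains are the chains of the incompatibility relation.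
  obtain ⟨M, hM, -⟩ := IsChain.exists_maxChain (r := fun a b : D => ¬ Compat a.1 b.1)
    (c := ∅) (by simp)
  have hsymm : ∀ {a b : P}, Compat a b → Compat b a := fun ⟨r, h, h'⟩ => ⟨r, h', h⟩
  refine ⟨Subtype.val '' M, by simp, ?_, fun p hp => ?_⟩
  · rintro _ ⟨a, ha, rfl⟩ _ ⟨b, hb, rfl⟩ hne
    exact (hM.1 ha hb fun h => hne (congrArg _ h)).elim id fun h h' => h (hsymm h')
  · by_contra! hc
    have hins : IsChain (fun a b : D => ¬ Compat a.1 b.1) (insert ⟨p, hp⟩ M) :=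
      hM.1.insert fun b hb _ => .inl (hc b.1 ⟨b, hb, rfl⟩)
    have hpM : (⟨p, hp⟩ : D) ∈ M := hM.2 hins (Set.subset_insert _ _) ▸ Set.mem_insert _ _
    exact hc p ⟨_, hpM, rfl⟩ ⟨p, le_rfl, le_rfl⟩

variable {T : Type u} [PartialOrder T] [IsTreeOrder T]

/-- A condition supported in `A` is determined by its stem, so its projection loses no information.
-/
theorem BMR.le_of_toQA_le {A : Set T} {p q : BMR T} (hq : (q.support : Set T) ⊆ A)
    (h : p.toQA A ≤ q.toQA A) : p ≤ q := fun t n ht =>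
  (BMR.restrict_val.1 (h.1 t n (BMR.restrict_val.2
    ⟨hq (Finset.mem_coe.2 (BMR.mem_support.2 ⟨n, ht⟩)), ht⟩))).2

/-- Countably many conditions live on a countable downward closed set of nodes. -/
theorem IsGenAronszajn.exists_countable_lowerSet (hT : IsGenAronszajn T) {W : Set (BMR T)}
    (hW : W.Countable) : ∃ A : Set T, (A.Nonempty ∧ A.Countable ∧ IsLowerSet A) ∧
      ∀ p ∈ W, (p.support : Set T) ⊆ A := by
  obtain ⟨t₀, -, -⟩ := hT.rooted
  let B : Set T := insert t₀ (⋃ p ∈ W, (p.support : Set T))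
  have hB : B.Countable := (hW.biUnion fun p _ => p.support.countable_toSet).insert t₀
  refine ⟨⋃ t ∈ B, Set.Iic t, ⟨⟨t₀, ?_⟩, hB.biUnion fun t _ => hT.countable_Iic t,
    isLowerSet_iUnion₂ fun t _ => isLowerSet_Iic t⟩, fun p hp t ht => ?_⟩
  · exact Set.mem_biUnion (Set.mem_insert _ _) (Set.mem_Iic.2 le_rfl)
  · exact Set.mem_biUnion (Set.mem_insert_of_mem _ (Set.mem_biUnion hp ht)) (Set.mem_Iic.2 le_rfl)

/-- Every countable set of ordinals in the extension has a name that depends on the restriction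
of the generic function to a countable set of nodes. -/
theorem IsGenAronszajn.exists_name_of_countable (hT : IsGenAronszajn T) {p : BMR T}
    {x : Name (BMR T)} (h : fCountableSetOfOrdinals x p) :
    ∃ (A : Set T) (_ : A.Nonempty ∧ A.Countable ∧ IsLowerSet A) (y : Name (QA A)),
      feq x (pull (fun p : BMR T => p.toQA A) y) p := by
  obtain ⟨hcount, hord⟩ := h
  -- a maximal antichain `E` of conditions `q ≤ p` that decide a name `f q` of an enumeration
  let enum : Name (BMR T) → BMR T → Prop := fun f q => fFunctional f q ∧
    fallIn x (fun y => fexIn (check PSet.omega.{u}) fun n => fmem (opair n y) f) q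
  obtain ⟨E, hE, hEanti, hEmax⟩ := exists_maximal_antichain {q | q ≤ p ∧ ∃ f, enum f q}
  have hex : ∀ q : E, ∃ f, enum f q.1 := fun q => (hE q.2).2
  choose f hf using hex
  -- maximal antichains `W q n` of conditions that decide the value `α` of `f q` at `n`
  let dec : E → ℕ → BMR T → Ordinal.{u} → Prop := fun q n r α =>
    fmem (opair (check (PSet.ofNat.{u} n)) (check α.toPSet)) (f q) r ∧ fmem (check α.toPSet) x r
  choose W hW hWanti hWmax using fun (q : E) (n : ℕ) =>
    exists_maximal_antichain {r | r ≤ q.1 ∧ ∃ α, dec q n r α}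
  have hdec : ∀ (q : E) n (r : W q n), ∃ α, dec q n r.1 α := fun q n r => (hW q n r.2).2
  choose α hα using hdec
  have := (hT.countable_of_antichain hEanti).to_subtype
  obtain ⟨A, hA, hWA⟩ := hT.exists_countable_lowerSet (W := ⋃ (q : E) (n : ℕ), W q n)
    (Set.countable_iUnion fun q => Set.countable_iUnion fun n =>
      hT.countable_of_antichain (hWanti q n))
  have hWA' : ∀ q n, ∀ r ∈ W q n, (r.support : Set T) ⊆ A := fun q n r hr =>
    hWA r (Set.mem_iUnion₂.2 ⟨q, n, hr⟩)
  let I : Type u := Σ (q : E) (n : ℕ), W q n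
  -- The name lists every decided ordinal, weighted by the projection of the condition deciding it.
  -- Members of `E` only serve as indices; their supports need not be in `A`.
  refine ⟨A, hA, .mk I (fun z => check (α z.1 z.2.1 z.2.2).toPSet) fun z => z.2.2.1.toQA A,
    feq_of_fsub (fun z q hq hz => fmem_of_dense fun q₀ hq₀ => ?_) ?_⟩
  · have hq₀p := hq₀.trans hq
    -- Extend until a member `e` of `E` is met, the index `n` and the ordinal `β` of `z` are known,
    -- and a member `w` of the `n`-th antichain below `e` is met. Functionality of the enumeration
    -- makes `β` the ordinal decided by `w`.
    obtain ⟨q₁, hq₁, f₁, hf₁⟩ := hcount q₀ hq₀p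
    obtain ⟨e, he, q₂, hq₂, hq₂e⟩ := hEmax q₁ ⟨hq₁.trans hq₀p, f₁, hf₁⟩
    have hq₂₀ := hq₂.trans hq₁
    have hz₂ := fmem_mono (hq₂₀.trans hq₀) hz
    obtain ⟨q₃, hq₃, m, hm, hmz⟩ := (hf ⟨e, he⟩).2 z q₂ hq₂e hz₂ q₂ le_rfl
    obtain ⟨q₄, hq₄, n, hn⟩ := exists_of_fmem_check_omega hm
    have hz₄ := fmem_mono (hq₄.trans hq₃) hz₂
    have hq₄p : q₄ ≤ p := hq₄.trans (hq₃.trans (hq₂₀.trans hq₀p))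
    obtain ⟨q₅, hq₅, β, hβ⟩ := exists_feq_check_of_fOrd (hord z q₄ hq₄p hz₄)
    have hq₅e : q₅ ≤ e := hq₅.trans (hq₄.trans (hq₃.trans hq₂e))
    have hpair := fmem_congr_left (opair_congr (feq_mono hq₅ hn) hβ)
      (fmem_mono (hq₅.trans hq₄) hmz)
    obtain ⟨w, hw, q₆, hq₆, hq₆w⟩ := hWmax ⟨e, he⟩ n q₅
      ⟨hq₅e, β, hpair, fmem_congr_left hβ (fmem_mono hq₅ hz₄)⟩
    have hαβ := (hf ⟨e, he⟩).1 _ _ _ q₆ (hq₆.trans hq₅e)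
      ⟨fmem_mono hq₆ hpair, fmem_mono hq₆w (hα ⟨e, he⟩ n ⟨w, hw⟩).1⟩
    refine ⟨q₆, hq₆.trans (hq₅.trans (hq₄.trans (hq₃.trans hq₂₀))), ?_⟩
    refine fmem_congr_left (feq_symm (feq_trans (feq_mono hq₆ hβ)
      (feq_trans hαβ (feq_symm (feq_pull_check (fun p : BMR T => p.toQA A) _ q₆))))) ?_
    let i : I := ⟨⟨e, he⟩, n, ⟨w, hw⟩⟩
    exact fmem_mk (ι := Σ i : I, {p : BMR T // p.toQA A ≤ i.2.2.1.toQA A})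
      (a := fun z => pull (fun p : BMR T => p.toQA A)
        (check (α z.1.1 z.1.2.1 z.1.2.2).toPSet)) (c := fun z => z.2.1)
      ⟨i, q₆, BMR.toQA_mono A hq₆w⟩ le_rfl
  · refine fsub_mk fun i q _ hqi => ?_
    obtain ⟨⟨e, n, w⟩, r, hr⟩ := i
    have hrw : r ≤ w.1 := BMR.le_of_toQA_le (hWA' e n w.1 w.2) hr
    exact fmem_congr_left (feq_symm (feq_pull_check _ _ q))
      (fmem_mono (le_trans hqi hrw) (hα e n w).2)

end CountableSets

end SpecialTree

theorem mainTheorem7 {T : Type u} [PartialOrder T] [IsTreeOrder T] (hT : IsGenAronszajn T)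
    (code : T → PSet.{u}) (hcode : ∀ s t : T, PSet.Equiv (code s) (code t) → s = t) :
    ∃ e : ∀ A : {A : Set T // A.Nonempty ∧ A.Countable ∧ IsLowerSet A},
        BMR T → Iter (QA A.1) (fR code A.1),
      (∀ A,
        SigmaCentered (QA A.1) ∧
        IsDenseEmb (e A) ∧
        (∀ p : BMR T,
          (∀ t n, (e A p).fst.stem.fn.val t = some n ↔ t ∈ A.1 ∧ p.fn.val t = some n) ∧
          feq (e A p).snd (checkRestrict code p A.1ᶜ) (e A p).fst) ∧
        IsProjection (fun p => (e A p).fst) ∧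
        ∀ p : BMR T, feq (pull (fun p => (e A p).fst) (hName code A.1)) (gName code A.1) p) ∧
      ∀ (p : BMR T) (x : Name (BMR T)), fCountableSetOfOrdinals x p →
        ∃ (A : {A : Set T // A.Nonempty ∧ A.Countable ∧ IsLowerSet A}) (y : Name (QA A.1)),
          feq x (pull (fun p => (e A p).fst) y) p := by
  refine ⟨fun A => embed hcode A.2.2.2, fun A => ⟨QA.sigmaCentered A.2.2.1,
    isDenseEmb_embed hT hcode A.2.2.2, fun p => ⟨fun t n => BMR.restrict_val, feq_refl _ _⟩,
    isProjection_toQA hT A.2.2.2 hcode, feq_pull_hName code A.1⟩, fun p x h => ?_⟩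
  obtain ⟨A, hA, y, hy⟩ := hT.exists_name_of_countable h
  exact ⟨⟨A, hA⟩, y, hy⟩
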